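/- **Conventions.** Let $G$ be a finite abelian group of odd order with dual group $\widehat G$. A *Bohr set* $B$ in $G$ is given by a set $\Gamma\subset\widehat G$ and a real number $\rho\ge 0$, which are part of the data; its underlying set, also written $B$, is $\mathrm{Bohr}(\Gamma,\rho)=\{x\in G: |\gamma(x)-1|\le\rho \text{ for all }\gamma\in\Gamma\}$. Its rank is $|\Gamma|$ and its radius is $\rho$; we write $B_\tau=\mathrm{Bohr}(\Gamma,\tau\rho)$ and $2\cdot B=\mathrm{Bohr}(\Gamma^{1/2},\rho)$, where $\Gamma^{1/2}=\{\gamma\in\widehat G:\gamma^2\in\Gamma\}$ (its underlying set is $\{2x:x\in B\}$). We write $\mathrm{Bohr}(\Lambda,\delta)\le \mathrm{Bohr}(\Gamma,\rho)$ if $\Lambda\supset\Gamma$ and $\delta\le\rho$. A Bohr set $B$ of rank $d$ is *regular* if $1-12d|\tau|\le |B_{1+\tau}|/|B|\le 1+12d|\tau|$ whenever $12d|\tau|\le 1$. For $A\subset G$ let $T(A)$ be the number of triples $(x,y,z)\in A^3$ with $x+z=2y$ (trivial ones included), let $1_A$ be the indicator function of $A$ and $\mu_A=1_A/|A|$; further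 $f*g(x)=\sum_{y\in G} f(y)g(x-y)$ and $\|f\|_\infty=\max_{x\in G}|f(x)|$. **Proposition (Main iterator).** There are absolute constants $c,C>0$ such that the following holds. Let $G$ be a finite abelian group of odd order, let $B\subset G$ be a regular Bohr set of rank $d\ge 1$ and radius $\rho\le 2$, let $\alpha>0$, and let $A\subset B$ be a set of relative density $|A|/|B|\ge\alpha$. Then either 1. (many three-term progressions) $T(A)\ge \exp\left(-Cd\log(2d/\alpha)\right)|A|^2$, or 2. (density increment) there is a regular Bohr set $T$, contained in $B$ as a set and with $T\le B$ or $T\le 2\cdot B$, of rank at most $d+C\alpha^{-1}\log(2/\alpha)^4$ and radius at least $c\rho\,\alpha^{C\log(2/\alpha)}/d^5$, such that $\|1_A*\mu_T\|_\infty\ge\tfrac98\alpha$. -/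

import Mathlib

open Finset

noncomputable section

/-- The data of a Bohr set in a finite abelian group `G`: a set of characters and a radius.
The rank and the radius belong to the data; they cannot be read off from the underlying set. -/
structure BohrSet (G : Type*) [AddCommGroup G] where
  freq : Finset (AddChar G ℂ)
  radius : ℝ
  radius_nonneg : 0 ≤ radius

/-- The set `{x ∈ G : |γ(x) - 1| ≤ ρ for all γ ∈ Γ}`. -/
def bohr {G : Type*} [AddCommGroup G] [Fintype G]
    (Γ : Finset (AddChar G ℂ)) (ρ : ℝ) : Finset G :=
  open Classical in univ.filter fun x => ∀ γ ∈ Γ, ‖γ x - 1‖ ≤ ρ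

namespace BohrSet

variable {G : Type*} [AddCommGroup G]

/-- The rank: the number of characters. -/
def rank (B : BohrSet G) : ℕ := B.freq.card

/-- `B' ≤ B` (sub-Bohr set): more characters and a smaller radius. -/
instance : LE (BohrSet G) where
  le B' B := B.freq ⊆ B'.freq ∧ B'.radius ≤ B.radius

variable [Fintype G]

/-- The underlying set of a Bohr set. -/
def carrier (B : BohrSet G) : Finset G := bohr B.freq B.radius

/-- The underlying set of `B_τ`, the Bohr set with the same characters and radius `τ ρ`. -/
def narrow (B : BohrSet G) (τ : ℝ) : Finset G := bohr B.freq (τ * B.radius)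

/-- Regularity of a Bohr set of rank `d`: `1 - 12 d |τ| ≤ |B_{1+τ}| / |B| ≤ 1 + 12 d |τ|`
whenever `|τ| ≤ 1 / (12 d)`. -/
def IsRegular (B : BohrSet G) : Prop :=
  ∀ τ : ℝ, 12 * (B.rank : ℝ) * |τ| ≤ 1 →
    1 - 12 * (B.rank : ℝ) * |τ| ≤ ((B.narrow (1 + τ)).card : ℝ) / (B.carrier.card : ℝ) ∧
    ((B.narrow (1 + τ)).card : ℝ) / (B.carrier.card : ℝ) ≤ 1 + 12 * (B.rank : ℝ) * |τ|

/-- The dilate `2 · B`, with characters `Γ^{1/2} = {γ : γ² ∈ Γ}` and the same radius. When `G` has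
odd order, squaring is a bijection of the dual group, the rank of `2 · B` is that of `B`, and the
underlying set of `2 · B` is `{2x : x ∈ B}`. -/
def double (B : BohrSet G) : BohrSet G where
  freq := open Classical in univ.filter fun γ => γ ^ 2 ∈ B.freq
  radius := B.radius
  radius_nonneg := B.radius_nonneg

end BohrSet

/-- The indicator function `1_A`. -/
def ind {G : Type*} (A : Finset G) : G → ℝ := Set.indicator (A : Set G) 1

/-- The function `μ_A = 1_A / |A|`. -/
def unif {G : Type*} (A : Finset G) : G → ℝ := fun x => ind A x / (A.card : ℝ)

/-- Convolution `f * g (x) = ∑_y f(y) g(x - y)`. -/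
def conv {G : Type*} [AddCommGroup G] [Fintype G] (f g : G → ℝ) : G → ℝ :=
  fun x => ∑ y, f y * g (x - y)

/-- The supremum norm of a function on a finite group. -/
def supNorm {G : Type*} (f : G → ℝ) : ℝ := ⨆ x, |f x|

/-- `T(A)`: the number of three-term progressions `(x, y, z) ∈ A³` with `x + z = 2y`, the trivial
ones included. -/
def numAP {G : Type*} [AddCommGroup G] (A : Finset G) : ℕ :=
  open Classical in ((A ×ˢ A ×ˢ A).filter fun p : G × G × G => p.1 + p.2.2 = 2 • p.2.1).card

end

/-! Fix two much narrower regular Bohr sets B₁, B₂ with the characters of B, of radii `r₁` and `r₂`.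
If A has density at least 9α/8 on a translate of either, that is the increment. Otherwise averaging
over the centre (`le_sum_conv_unif`) yields u at which both densities are at least 13α/16. Let A₁,
A₂ be the parts of A - u in B₁, B₂, put f = 1_{A₁} * μ_{A₁} and E = 2·A₂. Then |A₁| times the sum of
f over E counts progressions in A. If f exceeds α/100 on average over E, the size bound
`card_bohr_mul_ge` makes this count large.

Suppose instead that f is small on E. Random sampling (`exists_almostPeriods`) gives a dense subset
T of a narrow Bohr set such that translation by T - T changes f, at almost all points, by at most a
small multiple of f + α. Hence F = f * (μ_T * μ_{-T})^{(l)} is still small on average over E. Since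
the error is relative, about α⁻¹ samples suffice, up to logarithms, rather than α⁻²; this produces
the α⁻¹ in the rank.

With l of order log(2/α), characters outside the large spectrum of T contribute almost nothing to F.
Chang's theorem (`exists_bohr_annihilating_spectrum`) gives a Bohr set M with few extra characters
on which that spectrum is nearly trivial, so F is close to f * μ_M * μ_M
(`abs_convIter_sub_conv_conv_le`). If 1_{A₁} * μ_M stayed below 9α/8, its mean on B₁ would be well
above half of this ceiling, which forces f * μ_M * μ_M to be at least α/2 near the origin, in
particular on E (`half_le_conv_conv`). This is a contradiction, so M carries the increment. As E
lies in 2·B₂, the set M is built from the characters of 2·B. -/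

/-! ### Bohr sets: sums, reflections and dilation by 2. -/

section Bohr

variable {G : Type*} [AddCommGroup G] [Fintype G]

theorem mem_bohr {Γ : Finset (AddChar G ℂ)} {ρ : ℝ} {x : G} :
    x ∈ bohr Γ ρ ↔ ∀ γ ∈ Γ, ‖γ x - 1‖ ≤ ρ := by
  simp [bohr]

theorem bohr_mono {Γ : Finset (AddChar G ℂ)} {ρ σ : ℝ} (h : ρ ≤ σ) : bohr Γ ρ ⊆ bohr Γ σ :=
  fun _ hx => mem_bohr.2 fun γ hγ => (mem_bohr.1 hx γ hγ).trans h

theorem bohr_anti {Γ Δ : Finset (AddChar G ℂ)} {ρ : ℝ} (h : Γ ⊆ Δ) : bohr Δ ρ ⊆ bohr Γ ρ :=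
  fun _ hx => mem_bohr.2 fun γ hγ => mem_bohr.1 hx γ (h hγ)

theorem zero_mem_bohr {Γ : Finset (AddChar G ℂ)} {ρ : ℝ} (h : 0 ≤ ρ) : (0 : G) ∈ bohr Γ ρ :=
  mem_bohr.2 fun γ _ => by simpa using h

theorem card_bohr_pos {Γ : Finset (AddChar G ℂ)} {ρ : ℝ} (h : 0 ≤ ρ) :
    (0 : ℝ) < (bohr Γ ρ).card := by
  exact_mod_cast card_pos.2 ⟨0, zero_mem_bohr h⟩

theorem norm_addChar_add_sub_one_le (γ : AddChar G ℂ) (x y : G) :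
    ‖γ (x + y) - 1‖ ≤ ‖γ x - 1‖ + ‖γ y - 1‖ := by
  have h : γ (x + y) - 1 = (γ x - 1) + γ x * (γ y - 1) := by
    rw [AddChar.map_add_eq_mul]; ring
  rw [h]
  refine (norm_add_le _ _).trans ?_
  simp

theorem norm_addChar_neg_sub_one (γ : AddChar G ℂ) (x : G) : ‖γ (-x) - 1‖ = ‖γ x - 1‖ := by
  have h : γ (-x) - 1 = -(γ (-x) * (γ x - 1)) := by
    have : γ (-x) * γ x = 1 := by rw [← AddChar.map_add_eq_mul]; simp
    rw [mul_sub, this]; ring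
  rw [h, norm_neg, norm_mul]; simp

theorem add_mem_bohr {Γ : Finset (AddChar G ℂ)} {ρ σ : ℝ} {x y : G} (hx : x ∈ bohr Γ ρ)
    (hy : y ∈ bohr Γ σ) : x + y ∈ bohr Γ (ρ + σ) :=
  mem_bohr.2 fun γ hγ => (norm_addChar_add_sub_one_le γ x y).trans
    (add_le_add (mem_bohr.1 hx γ hγ) (mem_bohr.1 hy γ hγ))

theorem neg_mem_bohr {Γ : Finset (AddChar G ℂ)} {ρ : ℝ} {x : G} (hx : x ∈ bohr Γ ρ) :
    -x ∈ bohr Γ ρ :=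
  mem_bohr.2 fun γ hγ => by rw [norm_addChar_neg_sub_one]; exact mem_bohr.1 hx γ hγ

theorem sub_mem_bohr {Γ : Finset (AddChar G ℂ)} {ρ σ : ℝ} {x y : G} (hx : x ∈ bohr Γ ρ)
    (hy : y ∈ bohr Γ σ) : x - y ∈ bohr Γ (ρ + σ) := by
  rw [sub_eq_add_neg]; exact add_mem_bohr hx (neg_mem_bohr hy)

/-- The set `Γ^{1/2}` of square roots of the characters in `Γ`. -/
noncomputable def halfFreq (Γ : Finset (AddChar G ℂ)) : Finset (AddChar G ℂ) :=
  open Classical in univ.filter fun γ => γ ^ 2 ∈ Γ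

theorem mem_halfFreq {Γ : Finset (AddChar G ℂ)} {γ : AddChar G ℂ} :
    γ ∈ halfFreq Γ ↔ γ ^ 2 ∈ Γ := by
  simp [halfFreq]

theorem sq_addChar_bijective (hG : Odd (Fintype.card G)) :
    Function.Bijective fun γ : AddChar G ℂ => γ ^ 2 := by
  refine (Finite.injective_iff_bijective).1 ?_
  apply (powCoprime (G := AddChar G ℂ) (n := 2) ?_).injective
  rw [Nat.card_eq_fintype_card, AddChar.card_eq]
  exact Nat.coprime_comm.1 (Nat.coprime_two_left.2 hG)

theorem two_nsmul_bijective (hG : Odd (Fintype.card G)) :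
    Function.Bijective fun x : G => 2 • x := by
  refine (Finite.injective_iff_bijective).1 ?_
  apply (nsmulCoprime (G := G) (n := 2) ?_).injective
  rw [Nat.card_eq_fintype_card]
  exact Nat.coprime_comm.1 (Nat.coprime_two_left.2 hG)

theorem two_nsmul_mem_bohr_halfFreq (hG : Odd (Fintype.card G)) {Γ : Finset (AddChar G ℂ)} {ρ : ℝ}
    {x : G} : 2 • x ∈ bohr (halfFreq Γ) ρ ↔ x ∈ bohr Γ ρ := by
  simp only [mem_bohr]
  constructor
  · intro h γ hγ
    obtain ⟨χ, rfl⟩ := (sq_addChar_bijective hG).2 γ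
    have := h χ (mem_halfFreq.2 hγ)
    rwa [AddChar.map_nsmul_eq_pow] at this
  · intro h χ hχ
    have := h _ (mem_halfFreq.1 hχ)
    rwa [AddChar.map_nsmul_eq_pow]

theorem card_halfFreq (hG : Odd (Fintype.card G)) (Γ : Finset (AddChar G ℂ)) :
    (halfFreq Γ).card = Γ.card := by
  refine card_bij (fun γ _ => γ ^ 2) (fun γ hγ => mem_halfFreq.1 hγ)
    (fun γ _ χ _ h => (sq_addChar_bijective hG).1 h) fun γ hγ => ?_
  obtain ⟨χ, rfl⟩ := (sq_addChar_bijective hG).2 γ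
  exact ⟨χ, mem_halfFreq.2 hγ, rfl⟩

theorem card_bohr_halfFreq (hG : Odd (Fintype.card G)) (Γ : Finset (AddChar G ℂ)) (ρ : ℝ) :
    (bohr (halfFreq Γ) ρ).card = (bohr Γ ρ).card := by
  symm
  refine card_bij (fun x _ => 2 • x) (fun x hx => (two_nsmul_mem_bohr_halfFreq hG).2 hx)
    (fun x _ y _ h => (two_nsmul_bijective hG).1 h) fun y hy => ?_
  obtain ⟨x, rfl⟩ := (two_nsmul_bijective hG).2 y
  exact ⟨x, (two_nsmul_mem_bohr_halfFreq hG).1 hy, rfl⟩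

/-- Points of 2·B are sums x + x with x in B, so passing to the square-root characters costs only a
factor 2 in the radius. -/
theorem bohr_halfFreq_subset (hG : Odd (Fintype.card G)) (Γ : Finset (AddChar G ℂ)) (ρ : ℝ) :
    bohr (halfFreq Γ) ρ ⊆ bohr Γ (2 * ρ) := by
  intro y hy
  obtain ⟨x, rfl⟩ := (two_nsmul_bijective hG).2 y
  have := (two_nsmul_mem_bohr_halfFreq hG).1 hy
  simp only [two_nsmul, two_mul]
  exact add_mem_bohr this this

end Bohr

/-! ### Indicator functions, convolution and the Fourier transform. -/

section Convolution

variable {G : Type*}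

theorem ind_of_mem {A : Finset G} {x : G} (h : x ∈ A) : ind A x = 1 := by
  simp [ind, h]

theorem ind_of_notMem {A : Finset G} {x : G} (h : x ∉ A) : ind A x = 0 := by
  simp [ind, h]

theorem ind_nonneg (A : Finset G) (x : G) : 0 ≤ ind A x := by
  by_cases h : x ∈ A <;> simp [ind, h]

theorem ind_le_one (A : Finset G) (x : G) : ind A x ≤ 1 := by
  by_cases h : x ∈ A <;> simp [ind, h]

theorem unif_nonneg (A : Finset G) (x : G) : 0 ≤ unif A x :=
  div_nonneg (ind_nonneg A x) (Nat.cast_nonneg _)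

variable [Fintype G]

theorem sum_ind_mul (A : Finset G) (f : G → ℝ) : ∑ x, ind A x * f x = ∑ x ∈ A, f x := by
  classical
  rw [← sum_subset (subset_univ A)]
  · exact sum_congr rfl fun x hx => by rw [ind_of_mem hx, one_mul]
  · intro x _ hx
    rw [ind_of_notMem hx, zero_mul]

theorem sum_ind (A : Finset G) : ∑ x, ind A x = A.card := by
  simpa using sum_ind_mul A 1

theorem sum_unif_mul (A : Finset G) (f : G → ℝ) :
    ∑ x, unif A x * f x = (∑ x ∈ A, f x) / A.card := by
  rw [← sum_ind_mul A f, sum_div]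
  exact sum_congr rfl fun x _ => by rw [unif]; ring

theorem sum_unif {A : Finset G} (hA : A.Nonempty) : ∑ x, unif A x = 1 := by
  have := sum_unif_mul A 1
  simp only [Pi.one_apply, mul_one, sum_const, nsmul_eq_mul] at this
  rw [this, div_self]
  exact_mod_cast hA.card_pos.ne'

theorem le_supNorm (f : G → ℝ) (x : G) : f x ≤ supNorm f :=
  (le_abs_self _).trans (le_ciSup (f := fun x => |f x|) (Set.finite_range _).bddAbove x)

variable [AddCommGroup G]

theorem conv_eq_sum_sub (f g : G → ℝ) (x : G) : conv f g x = ∑ y, g y * f (x - y) := by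
  rw [conv]
  refine Fintype.sum_equiv (Equiv.subLeft x) _ _ fun y => ?_
  simp [mul_comm]

theorem conv_unif (f : G → ℝ) (A : Finset G) (x : G) :
    conv f (unif A) x = (∑ a ∈ A, f (x - a)) / A.card := by
  rw [conv_eq_sum_sub, sum_unif_mul]

theorem conv_nonneg {f g : G → ℝ} (hf : ∀ x, 0 ≤ f x) (hg : ∀ x, 0 ≤ g x) (x : G) :
    0 ≤ conv f g x :=
  sum_nonneg fun _ _ => mul_nonneg (hf _) (hg _)

theorem sum_conv (f g : G → ℝ) : ∑ x, conv f g x = (∑ x, f x) * ∑ x, g x := by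
  simp only [conv]
  rw [sum_comm, sum_mul]
  refine sum_congr rfl fun y _ => ?_
  rw [← mul_sum]
  congr 1
  exact Fintype.sum_equiv (Equiv.subRight y) _ _ fun x => rfl

/-- The function `f * ν * ⋯ * ν` with `n` factors `ν`. -/
def convIter (ν : G → ℝ) (n : ℕ) (f : G → ℝ) : G → ℝ := (fun g => conv g ν)^[n] f

theorem convIter_zero (ν f : G → ℝ) : convIter ν 0 f = f := rfl

theorem convIter_succ (ν : G → ℝ) (n : ℕ) (f : G → ℝ) :
    convIter ν (n + 1) f = conv (convIter ν n f) ν :=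
  Function.iterate_succ_apply' _ _ _

/-- The Fourier transform of a real function on a finite abelian group. -/
noncomputable def dft (f : G → ℝ) (γ : AddChar G ℂ) : ℂ := ∑ x, (f x : ℂ) * γ x

theorem dft_conv (f g : G → ℝ) (γ : AddChar G ℂ) : dft (conv f g) γ = dft f γ * dft g γ := by
  simp only [dft, conv, sum_mul_sum]
  push_cast
  simp_rw [sum_mul]
  rw [sum_comm]
  refine sum_congr rfl fun y _ => ?_
  refine Fintype.sum_equiv (Equiv.subRight y) _ _ fun x => ?_
  have : γ x = γ y * γ (x - y) := by rw [← AddChar.map_add_eq_mul]; simp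
  simp only [Equiv.subRight_apply]
  rw [this]; ring

theorem dft_convIter (ν : G → ℝ) (n : ℕ) (f : G → ℝ) (γ : AddChar G ℂ) :
    dft (convIter ν n f) γ = dft f γ * dft ν γ ^ n := by
  induction n with
  | zero => simp [convIter_zero]
  | succ n ih => rw [convIter_succ, dft_conv, ih]; ring

theorem dft_sub (f g : G → ℝ) (γ : AddChar G ℂ) : dft (f - g) γ = dft f γ - dft g γ := by
  simp [dft, sub_mul]

theorem dft_const_mul (c : ℝ) (f : G → ℝ) (γ : AddChar G ℂ) :
    dft (fun x => c * f x) γ = c * dft f γ := by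
  simp [dft, mul_sum, mul_assoc]

theorem dft_unif (A : Finset G) (γ : AddChar G ℂ) :
    dft (unif A) γ = dft (ind A) γ / A.card := by
  simp only [dft, unif, sum_div]
  push_cast
  exact sum_congr rfl fun _ _ => by ring

theorem dft_ind (A : Finset G) (γ : AddChar G ℂ) : dft (ind A) γ = ∑ x ∈ A, γ x := by
  classical
  rw [dft, ← sum_subset (subset_univ A)]
  · exact sum_congr rfl fun x hx => by simp [ind_of_mem hx]
  · intro x _ hx
    simp [ind_of_notMem hx]

theorem norm_dft_le {f : G → ℝ} (hf : ∀ x, 0 ≤ f x) (γ : AddChar G ℂ) :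
    ‖dft f γ‖ ≤ ∑ x, f x := by
  refine (norm_sum_le _ _).trans (sum_le_sum fun x _ => ?_)
  simp [abs_of_nonneg (hf x)]

theorem norm_dft_unif_le_one (A : Finset G) (γ : AddChar G ℂ) : ‖dft (unif A) γ‖ ≤ 1 := by
  rcases A.eq_empty_or_nonempty with rfl | hA
  · simp [dft, unif]
  · exact (norm_dft_le (unif_nonneg A) γ).trans (sum_unif hA).le

theorem dft_inversion (f : G → ℝ) (x : G) :
    (f x : ℂ) = (Fintype.card G : ℂ)⁻¹ * ∑ γ : AddChar G ℂ, dft f γ * γ (-x) := by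
  classical
  simp only [dft, sum_mul]
  rw [sum_comm]
  have h : ∀ y, ∑ γ : AddChar G ℂ, (f y : ℂ) * γ y * γ (-x) =
      if y = x then (f y : ℂ) * Fintype.card G else 0 := by
    intro y
    have : ∀ γ : AddChar G ℂ, (f y : ℂ) * γ y * γ (-x) = f y * γ (y - x) := fun γ => by
      rw [mul_assoc, ← AddChar.map_add_eq_mul, sub_eq_add_neg]
    simp_rw [this]
    rw [← mul_sum, AddChar.sum_apply_eq_ite]
    by_cases hyx : y = x
    · simp [hyx]
    · simp [hyx, sub_eq_zero]
  simp_rw [h]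
  rw [sum_ite_eq' univ x, if_pos (mem_univ _)]
  have : (Fintype.card G : ℂ) ≠ 0 := by exact_mod_cast Fintype.card_ne_zero
  field_simp

theorem dft_injective {f g : G → ℝ} (h : ∀ γ, dft f γ = dft g γ) : f = g := by
  funext x
  have : (f x : ℂ) = g x := by rw [dft_inversion f, dft_inversion g]; simp_rw [h]
  exact_mod_cast this

theorem sum_norm_dft_sq (f : G → ℝ) :
    ∑ γ : AddChar G ℂ, ‖dft f γ‖ ^ 2 = Fintype.card G * ∑ x, f x ^ 2 := by
  have hconj : ∀ γ : AddChar G ℂ, ((‖dft f γ‖ ^ 2 : ℝ) : ℂ) = ∑ x, f x * (dft f γ * γ (-x)) := by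
    intro γ
    have h1 : ((‖dft f γ‖ ^ 2 : ℝ) : ℂ) = dft f γ * (starRingEnd ℂ) (dft f γ) := by
      rw [Complex.mul_conj, Complex.normSq_eq_norm_sq]
    rw [h1]
    have h2 : (starRingEnd ℂ) (dft f γ) = ∑ x, (f x : ℂ) * γ (-x) := by
      simp only [dft, map_sum, map_mul, Complex.conj_ofReal]
      exact sum_congr rfl fun x _ => by rw [AddChar.map_neg_eq_conj]
    rw [h2, mul_sum]
    exact sum_congr rfl fun x _ => by ring
  have hN : (Fintype.card G : ℂ) ≠ 0 := by exact_mod_cast Fintype.card_ne_zero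
  have key : ((∑ γ : AddChar G ℂ, ‖dft f γ‖ ^ 2 : ℝ) : ℂ) =
      ((Fintype.card G * ∑ x, f x ^ 2 : ℝ) : ℂ) := by
    rw [Complex.ofReal_sum]
    simp_rw [hconj]
    rw [sum_comm]
    push_cast
    rw [mul_sum]
    refine sum_congr rfl fun x _ => ?_
    rw [← mul_sum]
    have := dft_inversion f x
    rw [eq_inv_mul_iff_mul_eq₀ hN] at this
    rw [← this]; ring
  exact_mod_cast key

/-- By Parseval, ‖dft (ind A) γ‖² / |A| has average 1 over all characters, so Fourier inversion
turns a bound relative to it into a pointwise bound. -/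
theorem abs_le_of_norm_dft_le {A : Finset G} (hA : A.Nonempty) {g : G → ℝ} {ε : ℝ}
    (h : ∀ γ, ‖dft g γ‖ ≤ ε * (‖dft (ind A) γ‖ ^ 2 / A.card)) (x : G) : |g x| ≤ ε := by
  have hN : (0 : ℝ) < Fintype.card G := by exact_mod_cast Fintype.card_pos
  have hA' : (0 : ℝ) < A.card := by exact_mod_cast hA.card_pos
  have hsq : ∑ x, ind A x ^ 2 = A.card := by
    rw [← sum_ind]
    refine sum_congr rfl fun x _ => ?_
    by_cases hx : x ∈ A
    · simp [ind_of_mem hx]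
    · simp [ind_of_notMem hx]
  have h1 : |g x| = ‖(g x : ℂ)‖ := by simp
  rw [h1, dft_inversion g x, norm_mul, norm_inv, Complex.norm_natCast, inv_mul_le_iff₀ hN]
  calc ‖∑ γ : AddChar G ℂ, dft g γ * γ (-x)‖ ≤ ∑ γ : AddChar G ℂ, ‖dft g γ‖ := by
        refine (norm_sum_le _ _).trans (sum_le_sum fun γ _ => ?_)
        simp
    _ ≤ ∑ γ : AddChar G ℂ, ε * (‖dft (ind A) γ‖ ^ 2 / A.card) := sum_le_sum fun γ _ => h γ
    _ = Fintype.card G * ε := by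
        rw [← mul_sum, ← sum_div, sum_norm_dft_sq, hsq]; field_simp

end Convolution

/-! ### Size of Bohr sets and existence of regular radii. -/

section Size

variable {G : Type*} [AddCommGroup G] [Fintype G]

theorem norm_sub_le_abs_arg_sub {z w : ℂ} (hz : ‖z‖ = 1) (hw : ‖w‖ = 1) :
    ‖z - w‖ ≤ |z.arg - w.arg| := by
  have h1 : z = Complex.exp (z.arg * Complex.I) := by
    conv_lhs => rw [← Complex.norm_mul_exp_arg_mul_I z, hz]
    simp
  have h2 : w = Complex.exp (w.arg * Complex.I) := by
    conv_lhs => rw [← Complex.norm_mul_exp_arg_mul_I w, hw]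
    simp
  have h3 : z - w = Complex.exp (w.arg * Complex.I) *
      (Complex.exp (Complex.I * ((z.arg - w.arg : ℝ) : ℂ)) - 1) := by
    rw [mul_sub, ← Complex.exp_add, mul_one, ← h2]
    conv_lhs => rw [h1]
    congr 2
    push_cast
    ring
  rw [h3, norm_mul, Complex.norm_exp_ofReal_mul_I, one_mul]
  exact Real.norm_exp_I_mul_ofReal_sub_one_le

theorem abs_arg_le_of_norm_sub_one_le {z : ℂ} (hz : ‖z‖ = 1) :
    |z.arg| ≤ Real.pi / 2 * ‖z - 1‖ := by
  have hz0 : z ≠ 0 := by rintro rfl; simp at hz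
  have := Complex.angle_le_mul_norm_sub hz (norm_one (α := ℂ))
  rwa [Complex.angle_one_right hz0] at this

/-- Narrowing a Bohr set of rank `d` by `τ` costs at most a factor `(τ / 5) ^ d` in size. -/
theorem card_bohr_mul_ge (Γ : Finset (AddChar G ℂ)) {ρ τ : ℝ} (hρ : 0 ≤ ρ) (hτ : 0 < τ)
    (hτ1 : τ ≤ 1) :
    (τ / 5) ^ Γ.card * ((bohr Γ ρ).card : ℝ) ≤ (bohr Γ (τ * ρ)).card := by
  classical
  rcases hρ.eq_or_lt with rfl | hρ
  · rw [mul_zero]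
    refine mul_le_of_le_one_left (Nat.cast_nonneg _) (pow_le_one₀ (by positivity) ?_)
    linarith
  set M : ℕ := ⌊Real.pi / τ⌋₊ with hM
  have hπ := Real.pi_pos
  have hσ : 0 < τ * ρ := mul_pos hτ hρ
  -- `F x` records, for each character, which arc of length τρ contains the argument. At most M + 1
  -- ≤ 5/τ arcs occur, since π + τ ≤ 5. Two points with the same record differ by an element of the
  -- narrower set, because a chord is no longer than its arc.
  let F : G → Γ → ℕ := fun x γ => ⌊((γ : AddChar G ℂ) x).arg / (τ * ρ) + Real.pi / (2 * τ)⌋₊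
  let t : Finset (Γ → ℕ) := Fintype.piFinset fun _ => range (M + 1)
  have hbound : ∀ x ∈ bohr Γ ρ, ∀ γ : Γ,
      |((γ : AddChar G ℂ) x).arg / (τ * ρ)| ≤ Real.pi / (2 * τ) := by
    intro x hx γ
    have h1 := abs_arg_le_of_norm_sub_one_le (AddChar.norm_apply (γ : AddChar G ℂ) x)
    have h2 := mem_bohr.1 hx γ γ.2
    rw [abs_div, abs_of_pos hσ, div_le_iff₀ hσ]
    calc _ ≤ Real.pi / 2 * ρ := h1.trans (by gcongr)
      _ = _ := by field_simp
  have hmaps : ∀ x ∈ bohr Γ ρ, F x ∈ t := by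
    intro x hx
    refine Fintype.mem_piFinset.2 fun γ => mem_range.2 (Nat.lt_succ_of_le (Nat.floor_mono ?_))
    have := (abs_le.1 (hbound x hx γ)).2
    have h3 : Real.pi / τ = Real.pi / (2 * τ) + Real.pi / (2 * τ) := by field_simp; ring
    linarith
  have ht : t.Nonempty := ⟨F 0, hmaps 0 (zero_mem_bohr hρ.le)⟩
  have htc : t.card = (M + 1) ^ Γ.card := by simp [t]
  have hMle : ((M : ℝ) + 1) * (τ / 5) ≤ 1 := by
    have h1 : (M : ℝ) ≤ Real.pi / τ := Nat.floor_le (by positivity)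
    have h2 : (M : ℝ) * τ ≤ Real.pi := by rwa [le_div_iff₀ hτ] at h1
    have := Real.pi_le_four
    nlinarith
  obtain ⟨b, -, hb⟩ := exists_le_card_fiber_of_nsmul_le_card_of_maps_to
    (b := (τ / 5) ^ Γ.card * ((bohr Γ ρ).card : ℝ)) hmaps ht (by
      rw [nsmul_eq_mul, htc, ← mul_assoc]
      refine mul_le_of_le_one_left (Nat.cast_nonneg _) ?_
      push_cast
      rw [← mul_pow]
      exact pow_le_one₀ (by positivity) hMle)
  refine hb.trans ?_
  rcases ((bohr Γ ρ).filter fun x => F x = b).eq_empty_or_nonempty with h0 | ⟨x₀, hx₀⟩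
  · rw [h0]; simp
  rw [Nat.cast_le]
  refine card_le_card_of_injOn (fun x => x - x₀) (fun x hx => ?_)
    fun x _ y _ h => sub_left_injective h
  simp only [coe_filter, Set.mem_ofPred_eq, mem_filter] at hx hx₀
  refine mem_bohr.2 fun γ hγ => ?_
  have hfl : F x ⟨γ, hγ⟩ = F x₀ ⟨γ, hγ⟩ := by rw [hx.2, hx₀.2]
  have e : γ (x - x₀) - 1 = γ (-x₀) * (γ x - γ x₀) := by
    rw [mul_sub, ← AddChar.map_add_eq_mul, ← AddChar.map_add_eq_mul]
    simp [sub_eq_neg_add]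
  rw [e, norm_mul, AddChar.norm_apply, one_mul]
  refine (norm_sub_le_abs_arg_sub (AddChar.norm_apply γ x) (AddChar.norm_apply γ x₀)).trans ?_
  have b1 := (abs_le.1 (hbound x hx.1 ⟨γ, hγ⟩)).1
  have b2 := (abs_le.1 (hbound x₀ hx₀.1 ⟨γ, hγ⟩)).1
  have f1 := Nat.floor_le (a := (γ x).arg / (τ * ρ) + Real.pi / (2 * τ)) (by linarith)
  have f2 := Nat.floor_le (a := (γ x₀).arg / (τ * ρ) + Real.pi / (2 * τ)) (by linarith)
  have f3 := Nat.lt_floor_add_one ((γ x).arg / (τ * ρ) + Real.pi / (2 * τ))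
  have f4 := Nat.lt_floor_add_one ((γ x₀).arg / (τ * ρ) + Real.pi / (2 * τ))
  simp only [F] at hfl
  rw [hfl] at f1 f3
  have : |(γ x).arg / (τ * ρ) - (γ x₀).arg / (τ * ρ)| ≤ 1 :=
    abs_le.2 ⟨by linarith, by linarith⟩
  rwa [← sub_div, abs_div, abs_of_pos hσ, div_le_one hσ] at this

/-- The regularity condition for the Bohr set with characters `Γ` and radius `ρ`. -/
def RegularRadius (Γ : Finset (AddChar G ℂ)) (ρ : ℝ) : Prop :=
  ∀ τ : ℝ, 12 * (Γ.card : ℝ) * |τ| ≤ 1 →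
    (1 - 12 * (Γ.card : ℝ) * |τ|) * (bohr Γ ρ).card ≤ (bohr Γ ((1 + τ) * ρ)).card ∧
    ((bohr Γ ((1 + τ) * ρ)).card : ℝ) ≤ (1 + 12 * (Γ.card : ℝ) * |τ|) * (bohr Γ ρ).card

theorem BohrSet.isRegular_iff (B : BohrSet G) : B.IsRegular ↔ RegularRadius B.freq B.radius := by
  have h := card_bohr_pos (Γ := B.freq) B.radius_nonneg
  simp only [BohrSet.IsRegular, RegularRadius, BohrSet.rank, BohrSet.narrow, BohrSet.carrier,
    le_div_iff₀ h, div_le_iff₀ h]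

theorem RegularRadius.halfFreq (hG : Odd (Fintype.card G)) {Γ : Finset (AddChar G ℂ)} {ρ : ℝ}
    (h : RegularRadius Γ ρ) : RegularRadius (halfFreq Γ) ρ := by
  intro τ hτ
  simp only [card_bohr_halfFreq hG, card_halfFreq hG] at hτ ⊢
  exact h τ hτ

theorem RegularRadius.card_le {Γ : Finset (AddChar G ℂ)} {ρ σ κ : ℝ} (h : RegularRadius Γ ρ)
    (hκ : 0 ≤ κ) (hκ1 : 12 * (Γ.card : ℝ) * κ ≤ 1) (hσ : σ ≤ (1 + κ) * ρ) :
    ((bohr Γ σ).card : ℝ) ≤ (1 + 12 * (Γ.card : ℝ) * κ) * (bohr Γ ρ).card := by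
  have := (h κ (by rwa [abs_of_nonneg hκ])).2
  rw [abs_of_nonneg hκ] at this
  refine le_trans ?_ this
  exact_mod_cast card_le_card (bohr_mono hσ)

theorem RegularRadius.le_card {Γ : Finset (AddChar G ℂ)} {ρ σ κ : ℝ} (h : RegularRadius Γ ρ)
    (hκ : 0 ≤ κ) (hκ1 : 12 * (Γ.card : ℝ) * κ ≤ 1) (hσ : (1 - κ) * ρ ≤ σ) :
    (1 - 12 * (Γ.card : ℝ) * κ) * (bohr Γ ρ).card ≤ ((bohr Γ σ).card : ℝ) := by
  have := (h (-κ) (by rwa [abs_neg, abs_of_nonneg hκ])).1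
  rw [abs_neg, abs_of_nonneg hκ] at this
  refine this.trans ?_
  exact_mod_cast card_le_card (bohr_mono (by linarith))

/-- A monotone, right locally constant function of small total variation has a point at which
all of its difference quotients on both sides are bounded. -/
theorem exists_forall_slope_le {g : ℝ → ℝ} (hg : Monotone g)
    (hr : ∀ t, ∃ t' > t, ∀ s, t ≤ s → s < t' → g s = g t) {c P p q Q : ℝ} (hc : 0 < c)
    (hPp : P ≤ p) (hpq : p ≤ q) (hqQ : q ≤ Q) (h : 2 * (g Q - g P) < c * (q - p)) :
    ∃ t ∈ Set.Icc p q, (∀ s ∈ Set.Icc t Q, g s - g t ≤ c * (s - t)) ∧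
      ∀ s ∈ Set.Icc P t, g t - g s ≤ c * (t - s) := by
  by_contra! hbad
  -- A rising-sun argument for both sides at once. `H` ≥ g exceeds g where a right slope is too
  -- large, `K` ≤ g is below g where a left slope is. Both are monotone, and at a bad point one of
  -- them starts to grow at rate c. If all of [p, q] were bad, U = H + K would gain c(q - p), but
  -- its gain is at most 2(g Q - g P). The set `Z` runs the continuous induction.
  set H : ℝ → ℝ := fun t => sSup ((fun s => g s - c * (s - t)) '' Set.Icc t Q) with hH
  set K : ℝ → ℝ := fun t => sInf ((fun s => g s + c * (t - s)) '' Set.Icc P t) with hK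
  have Hge : ∀ {t s}, t ≤ s → s ≤ Q → g s - c * (s - t) ≤ H t := by
    intro t s h1 h2
    refine le_csSup ⟨g Q, ?_⟩ ⟨s, ⟨h1, h2⟩, rfl⟩
    rintro _ ⟨r, hr, rfl⟩
    have := hg hr.2
    have := mul_nonneg hc.le (sub_nonneg.2 hr.1)
    simp only; linarith
  have Hle : ∀ {t b}, t ≤ Q → (∀ s, t ≤ s → s ≤ Q → g s - c * (s - t) ≤ b) → H t ≤ b := by
    intro t b h1 h2
    refine csSup_le ⟨_, ⟨t, ⟨le_rfl, h1⟩, rfl⟩⟩ ?_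
    rintro _ ⟨r, hr, rfl⟩
    exact h2 r hr.1 hr.2
  have Kle : ∀ {t s}, P ≤ s → s ≤ t → K t ≤ g s + c * (t - s) := by
    intro t s h1 h2
    refine csInf_le ⟨g P, ?_⟩ ⟨s, ⟨h1, h2⟩, rfl⟩
    rintro _ ⟨r, hr, rfl⟩
    have := hg hr.1
    have := mul_nonneg hc.le (sub_nonneg.2 hr.2)
    simp only; linarith
  have leK : ∀ {t b}, P ≤ t → (∀ s, P ≤ s → s ≤ t → b ≤ g s + c * (t - s)) → b ≤ K t := by
    intro t b h1 h2
    refine le_csInf ⟨_, ⟨t, ⟨h1, le_rfl⟩, rfl⟩⟩ ?_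
    rintro _ ⟨r, hr, rfl⟩
    exact h2 r hr.1 hr.2
  have Hmono : ∀ {t t'}, t ≤ t' → t' ≤ Q → H t ≤ H t' := by
    intro t t' h1 h2
    refine Hle (h1.trans h2) fun s hs hsQ => ?_
    rcases le_total t' s with h3 | h3
    · have := Hge h3 hsQ
      nlinarith
    · have h4 := Hge (le_refl t') h2
      have := hg h3
      nlinarith
  have Kmono : ∀ {t t'}, P ≤ t → t ≤ t' → K t ≤ K t' := by
    intro t t' h1 h2
    refine leK (h1.trans h2) fun s hs hsQ => ?_
    rcases le_total s t with h3 | h3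
    · have := Kle hs h3
      nlinarith
    · have h4 := Kle h1 (le_refl t)
      have := hg h3
      nlinarith
  set U : ℝ → ℝ := fun t => H t + K t with hU
  have Umono : ∀ {t t'}, P ≤ t → t ≤ t' → t' ≤ Q → U t ≤ U t' := fun h1 h2 h3 =>
    add_le_add (Hmono h2 h3) (Kmono h1 h2)
  set Z : Set ℝ := {t | t ∈ Set.Icc p q ∧ c * (t - p) ≤ U t - U p} with hZ
  have hpZ : p ∈ Z := ⟨⟨le_rfl, hpq⟩, by simp⟩
  have hZb : BddAbove Z := ⟨q, fun t ht => ht.1.2⟩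
  set m := sSup Z with hm
  have hpm : p ≤ m := le_csSup hZb hpZ
  have hmq : m ≤ q := csSup_le ⟨p, hpZ⟩ fun t ht => ht.1.2
  have hmZ : c * (m - p) ≤ U m - U p := by
    by_contra! hlt
    have : p + (U m - U p) / c < m := by
      have : (U m - U p) / c < m - p := by rw [div_lt_iff₀ hc]; linarith
      linarith
    obtain ⟨t, ht, htlt⟩ := exists_lt_of_lt_csSup ⟨p, hpZ⟩ this
    have h1 : U t ≤ U m := Umono (hPp.trans ht.1.1) (le_csSup hZb ht) (hmq.trans hqQ)
    have h2 := ht.2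
    have h3 : (U m - U p) / c < t - p := by linarith
    rw [div_lt_iff₀ hc] at h3
    linarith
  rcases hmq.eq_or_lt with hmeq | hmlt
  · have h1 : H q ≤ g Q := Hle hqQ fun s h1 h2 => by
      have := hg h2
      have := mul_nonneg hc.le (sub_nonneg.2 h1)
      linarith
    have h2 : K q ≤ g q := by simpa using Kle (hPp.trans hpq) (le_refl q)
    have h3 : g p ≤ H p := by simpa using Hge (le_refl p) (hpq.trans hqQ)
    have h4 : g P ≤ K p := leK hPp fun s h1 h2 => by
      have := hg h1
      have := mul_nonneg hc.le (sub_nonneg.2 h2)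
      linarith
    have := hg hPp
    have := hg hqQ
    rw [hmeq] at hmZ
    simp only [hU] at hmZ
    linarith
  · have hstep : ∃ t', m < t' ∧ t' ≤ q ∧ c * (t' - m) ≤ U t' - U m := by
      by_cases hR : ∀ s ∈ Set.Icc m Q, g s - g m ≤ c * (s - m)
      · obtain ⟨s, hs, hlt⟩ := hbad m ⟨hpm, hmq⟩ hR
        have hKm : K m < g m := (Kle hs.1 hs.2).trans_lt (by linarith)
        -- From m onwards `K` rises with slope at least c until it reaches the level g m.
        refine ⟨min q (m + (g m - K m) / c), lt_min hmlt ?_, min_le_left _ _, ?_⟩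
        · have := div_pos (sub_pos.2 hKm) hc
          linarith
        set t' := min q (m + (g m - K m) / c) with ht'
        have hmt : m ≤ t' := le_min hmq (by
          have := div_pos (sub_pos.2 hKm) hc
          linarith)
        have hct : c * (t' - m) ≤ g m - K m := by
          have : t' - m ≤ (g m - K m) / c := by
            have := min_le_right q (m + (g m - K m) / c)
            linarith
          rwa [le_div_iff₀ hc, mul_comm] at this
        have h1 : K m + c * (t' - m) ≤ K t' := leK (hPp.trans (hpm.trans hmt)) fun r hr1 hr2 => by
          rcases le_total r m with h3 | h3
          · have := Kle hr1 h3
            nlinarith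
          · have := hg h3
            have := mul_nonneg hc.le (sub_nonneg.2 hr2)
            linarith
        have h2 := Hmono hmt ((min_le_left _ _).trans hqQ)
        simp only [hU]
        linarith
      · push Not at hR
        obtain ⟨s, hs, hlt⟩ := hR
        have hHm : g m < H m := lt_of_lt_of_le (by linarith) (Hge hs.1 hs.2)
        obtain ⟨t₁, ht₁, hconst⟩ := hr m
        obtain ⟨t', hmt', ht'⟩ := exists_between (lt_min hmlt ht₁)
        have hmt : m ≤ t' := hmt'.le
        have htq : t' ≤ q := (ht'.trans_le (min_le_left _ _)).le
        refine ⟨t', hmt', htq, ?_⟩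
        -- Right local constancy: points before t' contribute at most g m, which is less than `H m`,
        -- so the supremum comes from points beyond t' and `H` gains c(t' - m).
        have h1 : H m ≤ max (g m) (H t' - c * (t' - m)) :=
          Hle (hmq.trans hqQ) fun r hr1 hr2 => by
            rcases lt_or_ge r t' with h3 | h3
            · refine le_max_of_le_left ?_
              rw [hconst r hr1 (h3.trans (ht'.trans_le (min_le_right _ _)))]
              have := mul_nonneg hc.le (sub_nonneg.2 hr1)
              linarith
            · refine le_max_of_le_right ?_
              have := Hge h3 hr2
              linarith
        have h2 : H m ≤ H t' - c * (t' - m) := by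
          rcases le_max_iff.1 h1 with h3 | h3
          · linarith
          · exact h3
        have h3 := Kmono (hPp.trans hpm) hmt
        simp only [hU]
        linarith
    obtain ⟨t', hmt', htq, hle⟩ := hstep
    have : t' ∈ Z := ⟨⟨hpm.trans hmt'.le, htq⟩, by linarith⟩
    exact absurd (le_csSup hZb this) (not_le.2 hmt')

/-- The defining conditions are closed and G is finite, so a slight increase of the radius admits no
new point. This is the right local constancy that `exists_forall_slope_le` asks for. -/
theorem exists_bohr_exp_mul_eq (Γ : Finset (AddChar G ℂ)) {ρ : ℝ} (hρ : 0 < ρ) (t : ℝ) :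
    ∃ t' > t, ∀ s, t ≤ s → s < t' → bohr Γ (Real.exp s * ρ) = bohr Γ (Real.exp t * ρ) := by
  have h1 : ∀ x : G, ∀ᶠ s in nhds t, x ∈ bohr Γ (Real.exp s * ρ) →
      x ∈ bohr Γ (Real.exp t * ρ) := by
    intro x
    by_cases hx : x ∈ bohr Γ (Real.exp t * ρ)
    · exact Filter.Eventually.of_forall fun _ _ => hx
    · have hx' := hx
      rw [mem_bohr] at hx'
      push Not at hx'
      obtain ⟨γ, hγ, hlt⟩ := hx'
      have hcont : ContinuousAt (fun s => Real.exp s * ρ) t := by fun_prop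
      filter_upwards [hcont.eventually_lt_const hlt] with s hs hxs
      exact absurd (mem_bohr.1 hxs γ hγ) (not_le.2 hs)
  have h2 := Filter.eventually_all.2 h1
  obtain ⟨ε, hε, hball⟩ := Metric.eventually_nhds_iff.1 h2
  refine ⟨t + ε, by linarith, fun s hts hs => ?_⟩
  refine Finset.Subset.antisymm (fun x hx => hball ?_ x hx) (bohr_mono ?_)
  · rw [Real.dist_eq, abs_of_nonneg (by linarith)]; linarith
  · gcongr

/-- Every Bohr set can be narrowed by a factor in `[1/4, 1]` so as to become regular. -/
theorem exists_regularRadius {Γ : Finset (AddChar G ℂ)} (hΓ : 1 ≤ Γ.card) {ρ : ℝ} (hρ : 0 ≤ ρ) :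
    ∃ σ, ρ / 4 ≤ σ ∧ σ ≤ ρ ∧ RegularRadius Γ σ := by
  rcases hρ.eq_or_lt with rfl | hρ
  · refine ⟨0, by simp, le_rfl, fun τ _ => ?_⟩
    rw [mul_zero]
    have h0 := card_bohr_pos (Γ := Γ) (le_refl (0 : ℝ))
    have h1 : 0 ≤ 12 * (Γ.card : ℝ) * |τ| := by positivity
    constructor <;> nlinarith
  set d : ℝ := (Γ.card : ℝ) with hd
  have hd1 : 1 ≤ d := by rw [hd]; exact_mod_cast hΓ
  set N : ℝ → ℝ := fun s => (bohr Γ (Real.exp s * ρ)).card with hN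
  have hNpos : ∀ s, 0 < N s := fun s => card_bohr_pos (by positivity)
  have hNmono : Monotone N := fun s t hst => by
    simp only [hN]
    exact_mod_cast card_le_card (bohr_mono (by gcongr))
  have hlog2 : Real.log 4 = 2 * Real.log 2 := by
    rw [show (4 : ℝ) = 2 ^ 2 by norm_num, Real.log_pow]; norm_num
  have hl1 := Real.log_two_gt_d9
  have hl2 := Real.log_two_lt_d9
  -- On a logarithmic scale over [-log 4, 0] the log-size varies by at most d(log 4 + log 5) ≤ 5d
  -- log 2, small enough for slope 8d. The margins 1/11 keep t + log(1 + τ) inside the interval when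
  -- |τ| ≤ 1/12.
  obtain ⟨t, ht, hright, hleft⟩ := exists_forall_slope_le (g := fun s => Real.log (N s))
    (fun s t hst => Real.log_le_log (hNpos s) (hNmono hst))
    (fun t => by
      obtain ⟨t', ht', h⟩ := exists_bohr_exp_mul_eq Γ hρ t
      exact ⟨t', ht', fun s h1 h2 => by simp only [hN, h s h1 h2]⟩)
    (c := 8 * d) (P := -Real.log 4) (p := -Real.log 4 + 1 / 11) (q := -(1 / 11)) (Q := 0)
    (by linarith) (by linarith) (by linarith) (by norm_num) (by
      have h := card_bohr_mul_ge Γ hρ.le (τ := 1 / 4) (by norm_num) (by norm_num)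
      have e1 : N 0 = (bohr Γ ρ).card := by simp [hN]
      have e2 : N (-Real.log 4) = (bohr Γ (1 / 4 * ρ)).card := by
        simp [hN, Real.exp_neg, Real.exp_log]
      rw [← e1, ← e2] at h
      have h2 := Real.log_le_log (mul_pos (by positivity) (hNpos 0)) h
      rw [Real.log_mul (by positivity) (hNpos 0).ne', Real.log_pow, ← hd] at h2
      have h3 : Real.log (1 / 4 / 5) = -(Real.log 4 + Real.log 5) := by
        rw [show (1 / 4 / 5 : ℝ) = (4 * 5)⁻¹ by norm_num, Real.log_inv,
          Real.log_mul (by norm_num) (by norm_num)]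
      have h5 : Real.log 5 ≤ 3 * Real.log 2 := by
        have : Real.log 5 ≤ Real.log (2 ^ 3) := Real.log_le_log (by norm_num) (by norm_num)
        rwa [Real.log_pow] at this
      rw [h3] at h2
      nlinarith)
  have hκle : ∀ κ, 0 ≤ κ → 12 * d * κ ≤ 1 → κ ≤ 1 / 12 := fun κ h0 h1 => by nlinarith
  refine ⟨Real.exp t * ρ, ?_, ?_, ?_⟩
  · have : Real.exp (-Real.log 4) ≤ Real.exp t := Real.exp_le_exp.2 (by linarith [ht.1])
    rw [Real.exp_neg, Real.exp_log (by norm_num)] at this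
    nlinarith
  · have : Real.exp t ≤ 1 := Real.exp_le_one_iff.2 (by linarith [ht.2])
    nlinarith
  · intro τ hτ
    rw [← hd] at hτ ⊢
    have hNt : ((bohr Γ (Real.exp t * ρ)).card : ℝ) = N t := rfl
    have hpos : 0 < 1 + τ := by
      have := hκle |τ| (abs_nonneg _) hτ
      have := neg_abs_le τ
      linarith
    have hNτ : ((bohr Γ ((1 + τ) * (Real.exp t * ρ))).card : ℝ) = N (t + Real.log (1 + τ)) := by
      simp only [hN, Real.exp_add, Real.exp_log hpos]
      congr 3; ring
    rw [hNt, hNτ]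
    have hNt0 := hNpos t
    have hu0 : 0 ≤ 12 * d * |τ| := by positivity
    have hκ := hκle |τ| (abs_nonneg _) hτ
    rcases le_total 0 τ with h0 | h0
    · have hlog0 : 0 ≤ Real.log (1 + τ) := Real.log_nonneg (by linarith)
      have hlogle : Real.log (1 + τ) ≤ τ := by
        have := Real.log_le_sub_one_of_pos hpos
        linarith
      rw [abs_of_nonneg h0] at hu0 hτ hκ ⊢
      refine ⟨?_, ?_⟩
      · have : N t ≤ N (t + Real.log (1 + τ)) := hNmono (by linarith)
        nlinarith
      · have h1 := hright (t + Real.log (1 + τ)) ⟨by linarith, by linarith [ht.2]⟩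
        have h2 : Real.log (N (t + Real.log (1 + τ))) ≤ Real.log (N t) + 8 * d * τ := by
          have : 8 * d * (t + Real.log (1 + τ) - t) ≤ 8 * d * τ := by
            have : t + Real.log (1 + τ) - t ≤ τ := by linarith
            gcongr
          linarith
        have h3 := Real.exp_le_exp.2 h2
        rw [Real.exp_add, Real.exp_log (hNpos _), Real.exp_log hNt0] at h3
        -- Slope 8 becomes 12 by convexity of exp on [0, 2/3], as e^{2/3} ≤ 2.
        have h4 : Real.exp (8 * d * τ) ≤ 1 + 12 * d * τ := by
          have hc := convexOn_exp.2 (Set.mem_univ 0) (Set.mem_univ (2 / 3))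
            (show 0 ≤ 1 - 12 * d * τ by linarith) hu0 (by ring)
          simp only [smul_eq_mul, mul_zero, zero_add, Real.exp_zero, mul_one] at hc
          have e : 12 * d * τ * (2 / 3) = 8 * d * τ := by ring
          rw [e] at hc
          have h5 : Real.exp (2 / 3) ≤ 2 :=
            (Real.exp_le_exp.2 (show 2 / 3 ≤ Real.log 2 by linarith)).trans_eq
              (Real.exp_log (by norm_num))
          nlinarith
        nlinarith
    · have hτ' : |τ| = -τ := abs_of_nonpos h0
      rw [hτ'] at hu0 hτ hκ ⊢
      have hlog0 : Real.log (1 + τ) ≤ 0 := Real.log_nonpos hpos.le (by linarith)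
      have hlogge : -(1 / 11) ≤ Real.log (1 + τ) := by
        have h1 := Real.one_sub_inv_le_log_of_pos hpos
        have h2 : (1 + τ)⁻¹ ≤ 12 / 11 := by
          rw [inv_le_comm₀ hpos (by norm_num)]
          linarith
        linarith
      refine ⟨?_, ?_⟩
      · have h1 := hleft (t + Real.log (1 + τ)) ⟨by linarith [ht.1], by linarith⟩
        have h2 : Real.log (N t) + 8 * d * Real.log (1 + τ) ≤ Real.log (N (t + Real.log (1 + τ))) := by
          linarith
        have h3 := Real.exp_le_exp.2 h2
        rw [Real.exp_add, Real.exp_log hNt0, Real.exp_log (hNpos _)] at h3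
        have h4 : 1 - 12 * d * -τ ≤ Real.exp (8 * d * Real.log (1 + τ)) := by
          have e : Real.exp (8 * d * Real.log (1 + τ)) = (1 + τ) ^ (8 * Γ.card) := by
            rw [← Real.exp_log (pow_pos hpos (8 * Γ.card)), Real.log_pow, hd]
            push_cast
            rfl
          rw [e]
          have := one_add_mul_le_pow (show -2 ≤ τ by linarith) (8 * Γ.card)
          push_cast at this
          rw [← hd] at this
          nlinarith
        nlinarith
      · have : N (t + Real.log (1 + τ)) ≤ N t := hNmono (by linarith)
        nlinarith

end Size

/-! ### Chernoff bounds for random samples. -/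

section Sampling

variable {G : Type*}

/-- The chord of exp over [0, s] keeps the exponent proportional to the mean of φ; hence the
deviations below can be measured relative to that mean. -/
theorem sum_exp_mul_le {A : Finset G} (hA : A.Nonempty) {φ : G → ℝ} (h0 : ∀ a, 0 ≤ φ a)
    (h1 : ∀ a, φ a ≤ 1) {s : ℝ} (hs : |s| ≤ 1) :
    ∑ a ∈ A, Real.exp (s * φ a) ≤
      A.card * Real.exp ((s + s ^ 2) * ((∑ a ∈ A, φ a) / A.card)) := by
  have hA' : (0 : ℝ) < A.card := by exact_mod_cast hA.card_pos
  have hexp : Real.exp s - 1 ≤ s + s ^ 2 := by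
    have := (abs_le.1 (Real.abs_exp_sub_one_sub_id_le hs)).2
    linarith
  have hpt : ∀ a, Real.exp (s * φ a) ≤ 1 + (s + s ^ 2) * φ a := by
    intro a
    have hc := convexOn_exp.2 (Set.mem_univ 0) (Set.mem_univ s)
      (show 0 ≤ 1 - φ a by linarith [h1 a]) (h0 a) (by ring)
    simp only [smul_eq_mul, mul_zero, zero_add, Real.exp_zero, mul_one] at hc
    rw [mul_comm s]
    nlinarith [h0 a]
  calc ∑ a ∈ A, Real.exp (s * φ a) ≤ ∑ a ∈ A, (1 + (s + s ^ 2) * φ a) :=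
        sum_le_sum fun a _ => hpt a
    _ = A.card * (1 + (s + s ^ 2) * ((∑ a ∈ A, φ a) / A.card)) := by
        rw [sum_add_distrib, ← mul_sum]
        simp only [sum_const, nsmul_eq_mul, mul_one]
        field_simp
    _ ≤ _ := by
        gcongr
        linarith [Real.add_one_le_exp ((s + s ^ 2) * ((∑ a ∈ A, φ a) / A.card))]

theorem sum_piFinset_exp_mul_le {A : Finset G} (hA : A.Nonempty) {φ : G → ℝ}
    (h0 : ∀ a, 0 ≤ φ a) (h1 : ∀ a, φ a ≤ 1) {s : ℝ} (hs : |s| ≤ 1) (k : ℕ) :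
    ∑ a ∈ Fintype.piFinset fun _ : Fin k => A, Real.exp (s * ∑ i, φ (a i)) ≤
      (A.card : ℝ) ^ k * Real.exp (k * ((s + s ^ 2) * ((∑ a ∈ A, φ a) / A.card))) := by
  have e : ∑ a ∈ Fintype.piFinset fun _ : Fin k => A, Real.exp (s * ∑ i, φ (a i)) =
      (∑ a ∈ A, Real.exp (s * φ a)) ^ k := by
    simp_rw [mul_sum, Real.exp_sum]
    rw [sum_prod_piFinset A fun (_ : Fin k) a => Real.exp (s * φ a)]
    simp
  rw [e, Real.exp_nat_mul, ← mul_pow]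
  exact pow_le_pow_left₀ (sum_nonneg fun _ _ => (Real.exp_pos _).le)
    (sum_exp_mul_le hA h0 h1 hs) k

open Classical in
/-- A multiplicative Chernoff bound for uniform samples from a finite set. -/
theorem card_piFinset_abs_sub_gt_le {A : Finset G} (hA : A.Nonempty) {φ : G → ℝ}
    (h0 : ∀ a, 0 ≤ φ a) (h1 : ∀ a, φ a ≤ 1) {δ α : ℝ} (hδ0 : 0 ≤ δ) (hδ1 : δ ≤ 1)
    {k : ℕ} (hk : 0 < k) :
    (((Fintype.piFinset fun _ : Fin k => A).filter fun a =>
      ¬ |(∑ i, φ (a i)) / k - (∑ a ∈ A, φ a) / A.card| ≤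
        δ * (α + (∑ a ∈ A, φ a) / A.card)).card : ℝ) ≤
      2 * Real.exp (-(k * (δ ^ 2 * α))) * (A.card : ℝ) ^ k := by
  set p := (∑ a ∈ A, φ a) / A.card with hp
  set Ω := Fintype.piFinset fun _ : Fin k => A with hΩ
  have hk' : (0 : ℝ) < k := by exact_mod_cast hk
  -- With s = ±δ the terms sp + s²p cancel against the threshold and exactly -kδ²α is left.
  have tail : ∀ s : ℝ, |s| = δ →
      ∑ a ∈ Ω, Real.exp (s * (∑ i, φ (a i)) - k * (s * p + δ ^ 2 * (α + p))) ≤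
        Real.exp (-(k * (δ ^ 2 * α))) * (A.card : ℝ) ^ k := by
    intro s hs
    have h := sum_piFinset_exp_mul_le hA h0 h1 (s := s) (by rw [hs]; exact hδ1) k
    rw [← hp, ← hΩ] at h
    have hs2 : s ^ 2 = δ ^ 2 := by rw [← hs, sq_abs]
    simp_rw [Real.exp_sub, ← sum_div]
    rw [div_le_iff₀ (Real.exp_pos _)]
    refine h.trans (le_of_eq ?_)
    rw [mul_comm (Real.exp _) (_ ^ k), mul_assoc, ← Real.exp_add, hs2]
    congr 2
    ring
  have hpt : ∀ a ∈ Ω, (if ¬ |(∑ i, φ (a i)) / k - p| ≤ δ * (α + p) then (1 : ℝ) else 0) ≤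
      Real.exp (δ * (∑ i, φ (a i)) - k * (δ * p + δ ^ 2 * (α + p))) +
      Real.exp (-δ * (∑ i, φ (a i)) - k * (-δ * p + δ ^ 2 * (α + p))) := by
    intro a _
    have hx : ∑ i, φ (a i) = k * ((∑ i, φ (a i)) / k) := by field_simp
    split_ifs with hc
    · positivity
    · rw [not_le, lt_abs] at hc
      rw [hx]
      rcases hc with hc | hc
      · refine le_add_of_le_of_nonneg (Real.one_le_exp ?_) (Real.exp_pos _).le
        have := mul_nonneg (mul_nonneg hk'.le hδ0) (sub_nonneg.2 hc.le)
        linarith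
      · refine le_add_of_nonneg_of_le (Real.exp_pos _).le (Real.one_le_exp ?_)
        have := mul_nonneg (mul_nonneg hk'.le hδ0) (sub_nonneg.2 hc.le)
        linarith
  rw [card_filter]
  push_cast
  refine (sum_le_sum hpt).trans ?_
  rw [sum_add_distrib]
  have t1 := tail δ (abs_of_nonneg hδ0)
  have t2 := tail (-δ) (by rw [abs_neg, abs_of_nonneg hδ0])
  linarith

end Sampling

/-! ### Almost-periods of 1_A * μ_A by sampling. -/

section AlmostPeriods

variable {G : Type*} [AddCommGroup G]

open Classical in
/-- One step of comparing averages of `u` over a set and over its translate. -/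
theorem sum_translate_le_of_almostPeriods {E X : Finset G} {u g : G → ℝ} {s s' : G} {δ β M : ℝ}
    (hδ0 : 0 ≤ δ) (hδ1 : δ ≤ 1 / 3) (hu0 : ∀ x, 0 ≤ u x) (huM : ∀ x, u x ≤ M)
    {T : Finset G} (hs : s ∈ T) (hs' : s' ∈ T)
    (hT : ∀ s ∈ T, ((X.filter fun x => ¬ ((1 - δ) * u x ≤ g (x + s) ∧
      g (x + s) ≤ (1 + δ) * u x)).card : ℝ) ≤ β * X.card)
    (hE : E ⊆ X) (hE' : ∀ x ∈ E, x + (s - s') ∈ X) :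
    ∑ x ∈ E, u (x + (s - s')) ≤ (1 + 3 * δ) * ∑ x ∈ E, u x + 2 * β * X.card * M := by
  set P : G → G → Prop := fun s x =>
    ¬ ((1 - δ) * u x ≤ g (x + s) ∧ g (x + s) ≤ (1 + δ) * u x) with hP
  have hM : 0 ≤ M := (hu0 0).trans (huM 0)
  have hpt : ∀ x ∈ E, u (x + (s - s')) ≤ (1 + 3 * δ) * u x +
      ((if P s x then M else 0) + if P s' (x + (s - s')) then M else 0) := by
    intro x _
    have h1 : 0 ≤ (1 + 3 * δ) * u x := mul_nonneg (by linarith) (hu0 x)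
    by_cases hx : P s x
    · have : (0 : ℝ) ≤ if P s' (x + (s - s')) then M else 0 := by split_ifs <;> simp [hM]
      rw [if_pos hx]
      linarith [huM (x + (s - s'))]
    by_cases hy : P s' (x + (s - s'))
    · rw [if_neg hx, if_pos hy]
      linarith [huM (x + (s - s'))]
    rw [if_neg hx, if_neg hy]
    simp only [hP, not_not] at hx hy
    -- Both u(x) and u(x + s - s') are compared with the same value g(x + s); then (1 + δ)/(1 - δ) ≤
    -- 1 + 3δ. Exceptional points cost M each.
    have e : x + (s - s') + s' = x + s := by abel
    rw [e] at hy
    have h2 := hy.1.trans hx.2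
    have h3 : (1 + δ) * u x ≤ (1 - δ) * ((1 + 3 * δ) * u x) := by
      have : 0 ≤ δ * (1 - 3 * δ) * u x := mul_nonneg (mul_nonneg hδ0 (by linarith)) (hu0 x)
      linarith
    have h4 := le_of_mul_le_mul_left (h2.trans h3) (by linarith)
    linarith
  refine (sum_le_sum hpt).trans ?_
  rw [sum_add_distrib, ← mul_sum, sum_add_distrib]
  have c1 : ∑ x ∈ E, (if P s x then M else 0) ≤ β * X.card * M := by
    rw [← sum_filter, sum_const, nsmul_eq_mul]
    refine mul_le_mul_of_nonneg_right (le_trans ?_ (hT s hs)) hM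
    exact_mod_cast card_le_card (filter_subset_filter _ hE)
  have c2 : ∑ x ∈ E, (if P s' (x + (s - s')) then M else 0) ≤ β * X.card * M := by
    rw [← sum_filter, sum_const, nsmul_eq_mul]
    refine mul_le_mul_of_nonneg_right (le_trans ?_ (hT s' hs')) hM
    rw [Nat.cast_le]
    refine card_le_card_of_injOn (fun x => x + (s - s')) (fun x hx => ?_)
      fun x _ y _ h => add_right_cancel h
    simp only [coe_filter, Set.mem_ofPred_eq] at hx ⊢
    exact ⟨hE' x hx.1, hx.2⟩
  linarith

variable [Fintype G]

open Classical in
/-- Almost-periodicity: on a large subset `T` of `S`, the translates of a single function `g`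
approximate `1_A * μ_A` at almost all points of `X`. -/
theorem exists_almostPeriods {A S X : Finset G} (hA : A.Nonempty) (hX : X.Nonempty)
    {α β δ K : ℝ} (hβ : 0 < β) (hδ0 : 0 ≤ δ) (hδ1 : δ ≤ 1) {k : ℕ} (hk : 0 < k)
    (hkβ : 2 * Real.exp (-(k * (δ ^ 2 * α))) ≤ β / 2)
    {AS : Finset G} (hAS : ∀ a ∈ A, ∀ s ∈ S, a + s ∈ AS) (hK : (AS.card : ℝ) ≤ K * A.card) :
    ∃ T ⊆ S, (S.card : ℝ) ≤ 2 * K ^ k * T.card ∧ ∃ g : G → ℝ, ∀ s ∈ T,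
      ((X.filter fun x => ¬ |g (x + s) - conv (ind A) (unif A) x| ≤
        δ * (α + conv (ind A) (unif A) x)).card : ℝ) ≤ β * X.card := by
  set f := conv (ind A) (unif A) with hf
  have hA' : (0 : ℝ) < A.card := by exact_mod_cast hA.card_pos
  have hX' : (0 : ℝ) < X.card := by exact_mod_cast hX.card_pos
  set Ω := Fintype.piFinset fun _ : Fin k => A with hΩ
  have hΩc : (Ω.card : ℝ) = (A.card : ℝ) ^ k := by simp [hΩ]
  let bad : (Fin k → G) → G → Prop := fun a x =>
    ¬ |(∑ i, ind A (x - a i)) / k - f x| ≤ δ * (α + f x)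
  let L := Ω.filter fun a => ((X.filter fun x => bad a x).card : ℝ) ≤ β * X.card
  have hbad : ∀ x, ((Ω.filter fun a => bad a x).card : ℝ) ≤ β / 2 * (A.card : ℝ) ^ k := by
    intro x
    have h := card_piFinset_abs_sub_gt_le hA (φ := fun a => ind A (x - a))
      (fun a => ind_nonneg _ _) (fun a => ind_le_one _ _) (α := α) hδ0 hδ1 hk
    rw [← conv_unif] at h
    exact h.trans (by gcongr)
  have hcount : ∑ a ∈ Ω, ((X.filter fun x => bad a x).card : ℝ) ≤
      X.card * (β / 2 * (A.card : ℝ) ^ k) := by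
    simp_rw [card_filter]
    push_cast
    rw [sum_comm]
    calc _ ≤ ∑ x ∈ X, β / 2 * (A.card : ℝ) ^ k := sum_le_sum fun x _ => by
          have := hbad x
          rw [card_filter] at this
          push_cast at this
          exact this
      _ = _ := by simp
  have hLc : (A.card : ℝ) ^ k / 2 ≤ L.card := by
    have h1 : ((Ω.filter fun a => ¬ ((X.filter fun x => bad a x).card : ℝ) ≤ β * X.card).card : ℝ) *
        (β * X.card) ≤ X.card * (β / 2 * (A.card : ℝ) ^ k) := by
      refine le_trans ?_ hcount
      refine le_trans ?_ (sum_le_sum_of_subset_of_nonneg (filter_subset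
        (fun a => ¬ ((X.filter fun x => bad a x).card : ℝ) ≤ β * X.card) Ω)
        fun _ _ _ => Nat.cast_nonneg _)
      rw [← nsmul_eq_mul]
      exact card_nsmul_le_sum _ _ _ fun a ha => (not_le.1 (mem_filter.1 ha).2).le
    have h2 := card_filter_add_card_filter_not (s := Ω)
      fun a => ((X.filter fun x => bad a x).card : ℝ) ≤ β * X.card
    have h3 : (L.card : ℝ) +
        (Ω.filter fun a => ¬ ((X.filter fun x => bad a x).card : ℝ) ≤ β * X.card).card =
        (A.card : ℝ) ^ k := by
      rw [← hΩc, ← h2]; push_cast; rfl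
    have h4 : ((Ω.filter fun a => ¬ ((X.filter fun x => bad a x).card : ℝ) ≤ β * X.card).card : ℝ) ≤
        (A.card : ℝ) ^ k / 2 := by
      refine le_of_mul_le_mul_right ?_ (mul_pos hβ hX')
      linarith
    linarith
  let t : Finset (Fin k → G) := Fintype.piFinset fun _ => AS
  have htc : (t.card : ℝ) ≤ K ^ k * (A.card : ℝ) ^ k := by
    simp only [t, Fintype.card_piFinset_const]
    push_cast
    rw [← mul_pow]
    gcongr
  rcases S.eq_empty_or_nonempty with rfl | hS
  · exact ⟨∅, Subset.rfl, by simp, 0, by simp⟩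
  have hL : L.Nonempty := by
    rw [← card_pos]
    have : (0 : ℝ) < L.card := lt_of_lt_of_le (by positivity) hLc
    exact_mod_cast this
  have hmaps : ∀ q ∈ L ×ˢ S, (fun i => q.1 i + q.2) ∈ t := by
    intro q hq
    rw [mem_product] at hq
    refine Fintype.mem_piFinset.2 fun i => hAS _ ?_ _ hq.2
    exact Fintype.mem_piFinset.1 (mem_filter.1 hq.1).1 i
  have ht : t.Nonempty := by
    obtain ⟨a, ha⟩ := hL
    obtain ⟨s, hs⟩ := hS
    exact ⟨_, hmaps (a, s) (mem_product.2 ⟨ha, hs⟩)⟩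
  have ht' : (0 : ℝ) < t.card := by exact_mod_cast ht.card_pos
  -- Pigeonhole on (a, s) ↦ a + s with a a good sample: a popular value b makes b - s good for many
  -- s. The empirical average along b - s at x is that along b at x + s, so one function g serves
  -- all of T.
  obtain ⟨b, -, hb⟩ := exists_le_card_fiber_of_nsmul_le_card_of_maps_to
    (b := ((L ×ˢ S).card : ℝ) / t.card) hmaps ht (by
      rw [nsmul_eq_mul, mul_div_cancel₀ _ ht'.ne'])
  let T := S.filter fun s => (fun i => b i - s) ∈ L
  refine ⟨T, filter_subset _ _, ?_, fun x => (∑ i, ind A (x - b i)) / k, fun s hs => ?_⟩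
  · have h1 : ((L ×ˢ S).filter fun q => (fun i => q.1 i + q.2) = b).card ≤ T.card := by
      refine card_le_card_of_injOn (fun q => q.2) (fun q hq => ?_) fun q hq q' hq' h => ?_
      · simp only [coe_filter, Set.mem_ofPred_eq, mem_product] at hq
        simp only [T, coe_filter, Set.mem_ofPred_eq]
        refine ⟨hq.1.2, ?_⟩
        rw [← hq.2]
        simpa using hq.1.1
      · simp only [coe_filter, Set.mem_ofPred_eq, mem_product] at hq hq'
        refine Prod.ext ?_ h
        funext i
        have := congrFun (hq.2.trans hq'.2.symm) i
        simp only at this h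
        rw [h] at this
        exact add_right_cancel this
    have h2 : ((L ×ˢ S).card : ℝ) / t.card ≤ T.card := hb.trans (by exact_mod_cast h1)
    rw [div_le_iff₀ ht', card_product] at h2
    push_cast at h2
    have hAk : (0 : ℝ) < (A.card : ℝ) ^ k := by positivity
    refine le_of_mul_le_mul_right ?_ hAk
    calc (S.card : ℝ) * (A.card : ℝ) ^ k = 2 * ((A.card : ℝ) ^ k / 2 * S.card) := by ring
      _ ≤ 2 * (L.card * S.card) := by gcongr
      _ ≤ 2 * (T.card * t.card) := by gcongr
      _ ≤ 2 * (T.card * (K ^ k * (A.card : ℝ) ^ k)) := by gcongr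
      _ = _ := by ring
  · have := (mem_filter.1 (mem_filter.1 hs).2).2
    simp only [bad] at this
    convert this using 11
    abel_nf

/-- The symmetrised uniform measure `μ_T * μ_{-T}`. -/
noncomputable def diffMeasure (T : Finset G) : G → ℝ := conv (unif T) fun x => unif T (-x)

theorem conv_diffMeasure (f : G → ℝ) (T : Finset G) (x : G) :
    conv f (diffMeasure T) x =
      (∑ s ∈ T, ∑ s' ∈ T, f (x + (s - s'))) / (T.card : ℝ) ^ 2 := by
  have h : conv f (diffMeasure T) x = ∑ s', unif T s' * ∑ s, unif T s * f (x + (s' - s)) := by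
    rw [conv_eq_sum_sub]
    simp only [diffMeasure, conv, sum_mul, mul_sum]
    rw [sum_comm]
    conv_rhs => rw [sum_comm]
    refine sum_congr rfl fun s _ => ?_
    refine Fintype.sum_equiv (Equiv.subLeft s) _ _ fun y => ?_
    simp only [Equiv.subLeft_apply, neg_sub]
    rw [show x + (s - y - s) = x - y by abel]
    ring
  rw [h, sum_unif_mul]
  simp_rw [sum_unif_mul]
  rw [← sum_div, div_div, sq]

theorem dft_diffMeasure (T : Finset G) (γ : AddChar G ℂ) :
    dft (diffMeasure T) γ = (‖dft (unif T) γ‖ ^ 2 : ℝ) := by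
  have h1 : ((‖dft (unif T) γ‖ ^ 2 : ℝ) : ℂ) =
      dft (unif T) γ * (starRingEnd ℂ) (dft (unif T) γ) := by
    rw [Complex.mul_conj, Complex.normSq_eq_norm_sq]
  rw [h1, diffMeasure, dft_conv]
  congr 1
  simp only [dft, map_sum, map_mul, Complex.conj_ofReal]
  refine Fintype.sum_equiv (Equiv.neg G) _ _ fun x => ?_
  rw [Equiv.neg_apply, AddChar.map_neg_eq_conj]
  simp

/-- If `h` is at least `c` near a point, so are its averages. -/
theorem le_convIter_diffMeasure {T : Finset G} (hT : T.Nonempty) {X : ℕ → Finset G}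
    (hX : ∀ n, ∀ x ∈ X (n + 1), ∀ s ∈ T, ∀ s' ∈ T, x + (s - s') ∈ X n) {h : G → ℝ} {c : ℝ}
    (hc : ∀ x ∈ X 0, c ≤ h x) (n : ℕ) : ∀ x ∈ X n, c ≤ convIter (diffMeasure T) n h x := by
  have hT' : (0 : ℝ) < T.card := by exact_mod_cast hT.card_pos
  induction n with
  | zero => simpa [convIter_zero] using hc
  | succ n ih =>
    intro x hx
    rw [convIter_succ, conv_diffMeasure, le_div_iff₀ (by positivity)]
    calc c * (T.card : ℝ) ^ 2 = ∑ s ∈ T, ∑ s' ∈ T, c := by simp; ring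
      _ ≤ _ := sum_le_sum fun s hs => sum_le_sum fun s' hs' => ih _ (hX n x hx s hs s' hs')

-- Each further convolution is an average over shifts s - s' in T - T, applied to the translate of
-- E. It costs one factor 1 + 3δ and one exceptional term; the sets `X n` shrink to leave room for
-- the remaining shifts.
open Classical in
theorem sum_convIter_le_of_almostPeriods {T : Finset G} (hTn : T.Nonempty) {X : ℕ → Finset G}
    (hX0 : ∀ n, X n ⊆ X 0)
    (hX : ∀ n, ∀ x ∈ X (n + 1), ∀ s ∈ T, ∀ s' ∈ T, x + (s - s') ∈ X n)
    {u g : G → ℝ} {δ β M : ℝ} (hδ0 : 0 ≤ δ) (hδ1 : δ ≤ 1 / 3) (hβ : 0 ≤ β)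
    (hu0 : ∀ x, 0 ≤ u x) (huM : ∀ x, u x ≤ M)
    (hT : ∀ s ∈ T, (((X 0).filter fun x => ¬ ((1 - δ) * u x ≤ g (x + s) ∧
      g (x + s) ≤ (1 + δ) * u x)).card : ℝ) ≤ β * (X 0).card) (n : ℕ) :
    ∀ E ⊆ X n, ∑ x ∈ E, convIter (diffMeasure T) n u x ≤
      (1 + 3 * δ) ^ n * (∑ x ∈ E, u x + n * (2 * β * (X 0).card * M)) := by
  have hT' : (0 : ℝ) < T.card := by exact_mod_cast hTn.card_pos
  have hM : 0 ≤ M := (hu0 0).trans (huM 0)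
  induction n with
  | zero => simp [convIter_zero]
  | succ n ih =>
    intro E hE
    set D := 2 * β * (X 0).card * M with hD
    have hD0 : 0 ≤ D := by positivity
    rw [convIter_succ]
    simp_rw [conv_diffMeasure]
    rw [← sum_div, div_le_iff₀ (by positivity), sum_comm]
    have key : ∀ s ∈ T, ∀ s' ∈ T, ∑ x ∈ E, convIter (diffMeasure T) n u (x + (s - s')) ≤
        (1 + 3 * δ) ^ (n + 1) * (∑ x ∈ E, u x + (n + 1 : ℕ) * D) := by
      intro s hs s' hs'
      have h1 := ih (E.map (addRightEmbedding (s - s'))) (by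
        intro y hy
        obtain ⟨x, hx, rfl⟩ := mem_map.1 hy
        exact hX n x (hE hx) s hs s' hs')
      simp only [sum_map, addRightEmbedding_apply] at h1
      have h2 := sum_translate_le_of_almostPeriods hδ0 hδ1 hu0 huM hs hs' hT
        (hE.trans (hX0 _)) (fun x hx => hX0 n (hX n x (hE hx) s hs s' hs'))
      refine h1.trans ?_
      rw [pow_succ, mul_assoc]
      refine mul_le_mul_of_nonneg_left ?_ (by positivity)
      push_cast
      have h3 : 0 ≤ 3 * δ * ((n + 1) * D) := by positivity
      rw [← hD] at h2
      linarith
    calc ∑ s ∈ T, ∑ x ∈ E, ∑ s' ∈ T, convIter (diffMeasure T) n u (x + (s - s'))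
        = ∑ s ∈ T, ∑ s' ∈ T, ∑ x ∈ E, convIter (diffMeasure T) n u (x + (s - s')) :=
          sum_congr rfl fun s _ => sum_comm
      _ ≤ ∑ s ∈ T, ∑ s' ∈ T, (1 + 3 * δ) ^ (n + 1) * (∑ x ∈ E, u x + (n + 1 : ℕ) * D) :=
          sum_le_sum fun s hs => sum_le_sum fun s' hs' => key s hs s' hs'
      _ = _ := by simp only [sum_const, nsmul_eq_mul]; ring

end AlmostPeriods

/-! ### Riesz products and the bound for dissociated characters. -/

section Riesz

variable {G : Type*} [AddCommGroup G] [Fintype G]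

theorem norm_zpow_apply_sub_one_le (χ : AddChar G ℂ) (x : G) {e : ℤ}
    (he : e ∈ ({-1, 0, 1} : Finset ℤ)) : ‖(χ ^ e) x - 1‖ ≤ ‖χ x - 1‖ := by
  simp only [mem_insert, mem_singleton] at he
  rcases he with rfl | rfl | rfl
  · rw [zpow_neg_one, AddChar.inv_apply, norm_addChar_neg_sub_one]
  · simp
  · simp

theorem norm_mul_apply_sub_one_le (χ ψ : AddChar G ℂ) (x : G) :
    ‖(χ * ψ) x - 1‖ ≤ ‖χ x - 1‖ + ‖ψ x - 1‖ := by
  have h : (χ * ψ) x - 1 = (χ x - 1) + χ x * (ψ x - 1) := by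
    rw [AddChar.mul_apply]; ring
  rw [h]
  refine (norm_add_le _ _).trans ?_
  simp

theorem norm_prod_apply_sub_one_le {ι : Type*} (s : Finset ι) (χ : ι → AddChar G ℂ) (x : G) :
    ‖(∏ i ∈ s, χ i) x - 1‖ ≤ ∑ i ∈ s, ‖χ i x - 1‖ := by
  classical
  induction s using Finset.induction_on with
  | empty => simp
  | insert i s hi ih =>
    rw [prod_insert hi, sum_insert hi]
    exact (norm_mul_apply_sub_one_le _ _ _).trans (by gcongr)

/-- Riesz product estimate: a weight whose Fourier transform is small at all nontrivial
`{-1, 0, 1}`-combinations of the characters `χ i`. -/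
theorem sum_mul_prod_le {ι : Type*} [Fintype ι] (χ : ι → AddChar G ℂ)
    (c : ι → ℂ) (hc : ∀ i, ‖c i‖ = 1) {w : G → ℝ} (hw0 : ∀ x, 0 ≤ w x) (hw1 : ∑ x, w x ≤ 1)
    {η a b : ℝ} (hη : 0 ≤ η) (ha : 0 ≤ a) (hb : 0 ≤ b)
    (h : ∀ e : ι → ℤ, (∀ i, e i ∈ ({-1, 0, 1} : Finset ℤ)) → e ≠ 0 →
      ‖dft w (∏ i, χ i ^ e i)‖ ≤ η) :
    ∑ x, w x * ∏ i, (a + 2 * b * (c i * χ i x).re) ≤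
      a ^ Fintype.card ι + (a + 2 * b) ^ Fintype.card ι * η := by
  classical
  set Z : Finset ℤ := {-1, 0, 1} with hZ
  -- Each factor is a trigonometric polynomial with exponents -1, 0, 1. After expanding the product,
  -- only the term e = 0 escapes the bound η.
  let coef : ι → ℤ → ℂ := fun i e =>
    if e = 0 then (a : ℂ) else if e = 1 then b * c i else b * (starRingEnd ℂ) (c i)
  have hcoef : ∀ i, ∀ e, ‖coef i e‖ = if e = 0 then a else b := by
    intro i e
    by_cases h0 : e = 0
    · simp [coef, h0, abs_of_nonneg ha]
    by_cases h1 : e = 1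
    · simp [coef, h1, abs_of_nonneg hb, hc]
    · simp [coef, h0, h1, abs_of_nonneg hb, hc]
  have hfac : ∀ x i, ((a + 2 * b * (c i * χ i x).re : ℝ) : ℂ) =
      ∑ e ∈ Z, coef i e * (χ i ^ e) x := by
    intro x i
    have hre : ((2 * (c i * χ i x).re : ℝ) : ℂ) =
        c i * χ i x + (starRingEnd ℂ) (c i) * χ i (-x) := by
      rw [AddChar.map_neg_eq_conj, ← map_mul, Complex.add_conj]
    have : ((a + 2 * b * (c i * χ i x).re : ℝ) : ℂ) =
        a + b * ((2 * (c i * χ i x).re : ℝ) : ℂ) := by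
      push_cast; ring
    rw [this, hre, hZ, sum_insert (by decide), sum_insert (by decide), sum_singleton]
    simp [coef]
    ring
  have hexp : ((∑ x, w x * ∏ i, (a + 2 * b * (c i * χ i x).re) : ℝ) : ℂ) =
      ∑ e ∈ Fintype.piFinset fun _ : ι => Z, (∏ i, coef i (e i)) * dft w (∏ i, χ i ^ e i) := by
    rw [Complex.ofReal_sum]
    have : ∀ x, ((w x * ∏ i, (a + 2 * b * (c i * χ i x).re) : ℝ) : ℂ) =
        ∑ e ∈ Fintype.piFinset fun _ : ι => Z,
          (∏ i, coef i (e i)) * ((w x : ℂ) * (∏ i, χ i ^ e i) x) := by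
      intro x
      rw [Complex.ofReal_mul, Complex.ofReal_prod]
      simp_rw [hfac x]
      rw [prod_univ_sum, mul_sum]
      refine sum_congr rfl fun e _ => ?_
      rw [prod_mul_distrib, AddChar.prod_apply]
      ring
    simp_rw [this]
    rw [sum_comm]
    refine sum_congr rfl fun e _ => ?_
    rw [dft, mul_sum]
  have hnorm : ∀ e ∈ Fintype.piFinset fun _ : ι => Z,
      ‖(∏ i, coef i (e i)) * dft w (∏ i, χ i ^ e i)‖ ≤
        (if e = 0 then a ^ Fintype.card ι else 0) + (∏ i, if e i = 0 then a else b) * η := by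
    intro e he
    rw [norm_mul, norm_prod]
    simp_rw [hcoef]
    by_cases h0 : e = 0
    · subst h0
      have : ‖dft w (∏ i, χ i ^ (0 : ι → ℤ) i)‖ ≤ 1 := (norm_dft_le hw0 _).trans hw1
      simp only [Pi.zero_apply, if_true, prod_const, card_univ]
      have h1 : 0 ≤ a ^ Fintype.card ι := by positivity
      refine le_add_of_le_of_nonneg ?_ (by positivity)
      exact mul_le_of_le_one_right h1 this
    · rw [if_neg h0, zero_add]
      refine mul_le_mul_of_nonneg_left (h e (fun i => Fintype.mem_piFinset.1 he i) h0) ?_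
      exact prod_nonneg fun i _ => by split_ifs <;> assumption
  have hle : ∑ x, w x * ∏ i, (a + 2 * b * (c i * χ i x).re) ≤
      ‖((∑ x, w x * ∏ i, (a + 2 * b * (c i * χ i x).re) : ℝ) : ℂ)‖ := by
    rw [Complex.norm_real]; exact le_abs_self _
  refine hle.trans ?_
  rw [hexp]
  refine (norm_sum_le _ _).trans ((sum_le_sum hnorm).trans ?_)
  rw [sum_add_distrib, ← sum_mul, sum_ite_eq' (Fintype.piFinset fun _ : ι => Z)]
  have hs : ∑ e ∈ Fintype.piFinset fun _ : ι => Z, ∏ i, (if e i = 0 then a else b) =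
      (a + 2 * b) ^ Fintype.card ι := by
    rw [sum_prod_piFinset Z fun (_ : ι) e => if e = 0 then a else b]
    rw [prod_const, card_univ]
    congr 1
    rw [hZ, sum_insert (by decide), sum_insert (by decide), sum_singleton]
    simp
    ring
  rw [hs]
  gcongr
  split_ifs
  · exact le_rfl
  · positivity

/-- With phases c i aligned to the coefficients, F = ∑ Re(c i χ i) has mean at least k/2 on T.
Jensen gives e^{k/4} ≤ M ∑ w e^{F/2}, and the Riesz product bounds the last sum by cosh(1/2)^k +
(e^{1/2}/2)^k ≤ 2e^{k/8}. -/
theorem card_le_log_of_riesz {ι : Type*} [Fintype ι] (χ : ι → AddChar G ℂ) {T : Finset G}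
    (hT : T.Nonempty) (hχ : ∀ i, 1 / 2 ≤ ‖dft (unif T) (χ i)‖) {w : G → ℝ}
    (hw0 : ∀ x, 0 ≤ w x) (hw1 : ∑ x, w x ≤ 1) {M : ℝ} (hM : 0 < M)
    (hTw : ∀ x, unif T x ≤ M * w x)
    (h : ∀ e : ι → ℤ, (∀ i, e i ∈ ({-1, 0, 1} : Finset ℤ)) → e ≠ 0 →
      ‖dft w (∏ i, χ i ^ e i)‖ ≤ (1 / 2) ^ Fintype.card ι) :
    (Fintype.card ι : ℝ) ≤ 8 * Real.log (2 * M) := by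
  set k := Fintype.card ι with hk
  have hne : ∀ i, dft (unif T) (χ i) ≠ 0 := fun i h0 => by
    have := hχ i
    rw [h0, norm_zero] at this
    linarith
  let c : ι → ℂ := fun i => (starRingEnd ℂ) (dft (unif T) (χ i)) / ‖dft (unif T) (χ i)‖
  have hc : ∀ i, ‖c i‖ = 1 := fun i => by
    simp only [c, norm_div, RCLike.norm_conj, Complex.norm_real, norm_norm]
    exact div_self (norm_ne_zero_iff.2 (hne i))
  have hcd : ∀ i, c i * dft (unif T) (χ i) = ‖dft (unif T) (χ i)‖ := fun i => by
    have hn : (‖dft (unif T) (χ i)‖ : ℂ) ≠ 0 := by exact_mod_cast norm_ne_zero_iff.2 (hne i)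
    simp only [c]
    rw [div_mul_eq_mul_div, div_eq_iff hn, mul_comm, Complex.mul_conj, Complex.normSq_eq_norm_sq]
    push_cast; ring
  set F : G → ℝ := fun x => ∑ i, (c i * χ i x).re with hF
  have hmean : (k : ℝ) / 2 ≤ ∑ x, unif T x * F x := by
    have : ∑ x, unif T x * F x = ∑ i, ‖dft (unif T) (χ i)‖ := by
      simp only [hF, mul_sum]
      rw [sum_comm]
      refine sum_congr rfl fun i _ => ?_
      have := congrArg Complex.re (hcd i)
      rw [Complex.ofReal_re, dft, mul_sum, Complex.re_sum] at this
      rw [dft, ← this]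
      refine sum_congr rfl fun x _ => ?_
      rw [mul_left_comm, Complex.re_ofReal_mul]
    rw [this]
    calc (k : ℝ) / 2 = ∑ _i : ι, (1 / 2 : ℝ) := by simp [hk]; ring
      _ ≤ _ := sum_le_sum fun i _ => hχ i
  have hjensen : Real.exp (∑ x, unif T x * (F x / 2)) ≤ ∑ x, unif T x * Real.exp (F x / 2) := by
    have := convexOn_exp.map_sum_le (t := univ) (w := unif T) (p := fun x => F x / 2)
      (fun x _ => unif_nonneg T x) (sum_unif hT) (fun x _ => Set.mem_univ _)
    simpa only [smul_eq_mul] using this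
  have hprod : ∀ x, Real.exp (F x / 2) ≤
      ∏ i, (Real.cosh (1 / 2) + 2 * (Real.sinh (1 / 2) / 2) * (c i * χ i x).re) := by
    intro x
    have : F x / 2 = ∑ i, (c i * χ i x).re * (1 / 2) := by
      simp only [hF, ← sum_mul]; ring
    rw [this, Real.exp_sum]
    refine prod_le_prod (fun i _ => (Real.exp_pos _).le) fun i _ => ?_
    have hre : |(c i * χ i x).re| ≤ 1 := (Complex.abs_re_le_norm _).trans (by simp [hc])
    have := Real.exp_mul_le_cosh_add_mul_sinh hre (1 / 2)
    linarith
  have hsinh : 0 ≤ Real.sinh (1 / 2) := Real.sinh_nonneg_iff.2 (by norm_num)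
  have hriesz := sum_mul_prod_le χ c hc hw0 hw1 (η := (1 / 2) ^ k) (a := Real.cosh (1 / 2))
    (b := Real.sinh (1 / 2) / 2) (by positivity) (Real.cosh_pos _).le (by linarith) h
  have hcosh : Real.cosh (1 / 2) ≤ Real.exp (1 / 8) := by
    refine (Real.cosh_le_exp_half_sq _).trans (Real.exp_le_exp.2 (by norm_num))
  have hexp2 : Real.exp (1 / 2) ≤ 2 := by
    refine (Real.exp_le_exp.2 ?_).trans_eq (Real.exp_log (by norm_num : (0 : ℝ) < 2))
    linarith [Real.log_two_gt_d9]
  have hsum : Real.cosh (1 / 2) + 2 * (Real.sinh (1 / 2) / 2) = Real.exp (1 / 2) := by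
    rw [← Real.cosh_add_sinh]; ring
  have hfinal : Real.exp (k / 4) ≤ M * (2 * Real.exp (k / 8)) := by
    calc Real.exp (k / 4) ≤ Real.exp (∑ x, unif T x * (F x / 2)) := by
          refine Real.exp_le_exp.2 ?_
          have : ∑ x, unif T x * (F x / 2) = (∑ x, unif T x * F x) / 2 := by
            rw [sum_div]; exact sum_congr rfl fun x _ => by ring
          rw [this]; linarith
      _ ≤ ∑ x, unif T x * Real.exp (F x / 2) := hjensen
      _ ≤ ∑ x, M * (w x * ∏ i, (Real.cosh (1 / 2) +
            2 * (Real.sinh (1 / 2) / 2) * (c i * χ i x).re)) := by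
          refine sum_le_sum fun x _ => ?_
          rw [← mul_assoc]
          exact mul_le_mul (hTw x) (hprod x) (Real.exp_pos _).le (mul_nonneg hM.le (hw0 x))
      _ ≤ M * (Real.cosh (1 / 2) ^ k + Real.exp (1 / 2) ^ k * (1 / 2) ^ k) := by
          rw [← mul_sum, ← hsum]
          exact mul_le_mul_of_nonneg_left hriesz hM.le
      _ ≤ M * (2 * Real.exp (k / 8)) := by
          refine mul_le_mul_of_nonneg_left ?_ hM.le
          have e1 : Real.exp (1 / 8) ^ k = Real.exp (k / 8) := by
            rw [← Real.exp_nat_mul]; congr 1; ring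
          have h1 : Real.cosh (1 / 2) ^ k ≤ Real.exp (k / 8) := by
            rw [← e1]; exact pow_le_pow_left₀ (Real.cosh_pos _).le hcosh k
          have h2 : Real.exp (1 / 2) ^ k * (1 / 2) ^ k ≤ 1 := by
            rw [← mul_pow]
            exact pow_le_one₀ (by positivity) (by linarith)
          have h3 : 1 ≤ Real.exp ((k : ℝ) / 8) := Real.one_le_exp (by positivity)
          linarith
  have h8 : Real.exp ((k : ℝ) / 8) ≤ 2 * M := by
    have e : Real.exp ((k : ℝ) / 4) = Real.exp (k / 8) * Real.exp (k / 8) := by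
      rw [← Real.exp_add]; congr 1; ring
    rw [e] at hfinal
    refine le_of_mul_le_mul_right ?_ (Real.exp_pos ((k : ℝ) / 8))
    linarith
  have := (Real.le_log_iff_exp_le (by linarith)).2 h8
  linarith

end Riesz

/-! ### Chang's theorem relative to a Bohr set. -/

section Spectrum

variable {G : Type*} [AddCommGroup G] [Fintype G]

/-- A character with a large Fourier coefficient on a regular Bohr set is almost constant on a
narrower one. -/
theorem norm_sub_one_le_of_half_lt {Γ : Finset (AddChar G ℂ)} {v κ : ℝ} (hv : 0 ≤ v)
    (hreg : RegularRadius Γ v) (hκ : 0 ≤ κ) (hκ1 : 12 * (Γ.card : ℝ) * κ ≤ 1) {χ : AddChar G ℂ}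
    (hχ : 1 / 2 < ‖dft (unif (bohr Γ v)) χ‖) {x : G} (hx : x ∈ bohr Γ (κ * v)) :
    ‖χ x - 1‖ ≤ 48 * Γ.card * κ := by
  classical
  set V := bohr Γ v with hV
  have hVpos : (0 : ℝ) < V.card := card_bohr_pos hv
  set W := V.map (addRightEmbedding x) with hW
  have hWc : W.card = V.card := card_map _
  have hinter : (1 - 12 * (Γ.card : ℝ) * κ) * V.card ≤ (V ∩ W).card := by
    refine (hreg.le_card hκ hκ1 le_rfl).trans ?_
    rw [Nat.cast_le]
    refine card_le_card fun y hy => mem_inter.2 ⟨?_, ?_⟩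
    · exact bohr_mono (by nlinarith) hy
    · refine mem_map.2 ⟨y - x, ?_, by simp⟩
      have := sub_mem_bohr hy hx
      rwa [← add_mul, sub_add_cancel, one_mul] at this
  have c1 : ((V \ W).card : ℝ) ≤ 12 * Γ.card * κ * V.card := by
    have := card_inter_add_card_sdiff V W
    have : ((V ∩ W).card : ℝ) + (V \ W).card = V.card := by exact_mod_cast this
    linarith
  have c2 : ((W \ V).card : ℝ) ≤ 12 * Γ.card * κ * V.card := by
    have := card_inter_add_card_sdiff W V
    rw [inter_comm, hWc] at this
    have : ((V ∩ W).card : ℝ) + (W \ V).card = V.card := by exact_mod_cast this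
    linarith
  -- By regularity V and V + x nearly coincide, so multiplying the coefficient by χ x hardly changes
  -- it.
  have hid : dft (ind V) χ * (χ x - 1) = ∑ y ∈ W \ V, χ y - ∑ y ∈ V \ W, χ y := by
    rw [sum_sdiff_sub_sum_sdiff, hW, sum_map, dft_ind, mul_sub, mul_one, sum_mul]
    congr 1
    refine sum_congr rfl fun y _ => ?_
    rw [addRightEmbedding_apply, AddChar.map_add_eq_mul]
  have hle : ‖dft (ind V) χ * (χ x - 1)‖ ≤ 24 * Γ.card * κ * V.card := by
    rw [hid]
    refine (norm_sub_le _ _).trans ?_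
    have n1 : ‖∑ y ∈ W \ V, χ y‖ ≤ (W \ V).card := (norm_sum_le _ _).trans (by simp)
    have n2 : ‖∑ y ∈ V \ W, χ y‖ ≤ (V \ W).card := (norm_sum_le _ _).trans (by simp)
    linarith
  rw [norm_mul] at hle
  have hχ' : (V.card : ℝ) / 2 ≤ ‖dft (ind V) χ‖ := by
    rw [dft_unif, norm_div, Complex.norm_natCast, lt_div_iff₀ hVpos] at hχ
    linarith
  have h3 : (V.card : ℝ) / 2 * ‖χ x - 1‖ ≤ 24 * Γ.card * κ * V.card :=
    (mul_le_mul_of_nonneg_right hχ' (norm_nonneg _)).trans hle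
  refine le_of_mul_le_mul_left ?_ (half_pos hVpos)
  linarith

/-- A set of characters is dissociated relative to `V` if all nontrivial `{-1, 0, 1}`-combinations
have a small Fourier coefficient on `V`. -/
def RelDissociated (V : Finset G) (Λ : Finset (AddChar G ℂ)) : Prop :=
  ∀ e : AddChar G ℂ → ℤ, (∀ χ, e χ ∈ ({-1, 0, 1} : Finset ℤ)) → (∃ χ ∈ Λ, e χ ≠ 0) →
    ‖dft (unif V) (∏ χ ∈ Λ, χ ^ e χ)‖ ≤ 1 / 2

theorem RelDissociated.mono {V : Finset G} {Λ Λ' : Finset (AddChar G ℂ)} (h : RelDissociated V Λ)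
    (hΛ : Λ' ⊆ Λ) : RelDissociated V Λ' := by
  classical
  rintro e he ⟨χ, hχ, hχ0⟩
  have := h (fun ψ => if ψ ∈ Λ' then e ψ else 0) (fun ψ => by
    by_cases hψ : ψ ∈ Λ'
    · simpa [hψ] using he ψ
    · simp [hψ]) ⟨χ, hΛ hχ, by simp [hχ, hχ0]⟩
  rw [← prod_subset hΛ (fun ψ _ hψ => by simp [hψ])] at this
  rwa [prod_congr rfl fun ψ hψ => by rw [if_pos hψ]] at this

theorem le_convIter_unif {V : Finset G} (hV : V.Nonempty) {X : ℕ → Finset G}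
    (hX : ∀ n, ∀ x ∈ X (n + 1), ∀ v ∈ V, x - v ∈ X n) {h : G → ℝ} {c : ℝ}
    (hc : ∀ x ∈ X 0, c ≤ h x) (n : ℕ) : ∀ x ∈ X n, c ≤ convIter (unif V) n h x := by
  have hV' : (0 : ℝ) < V.card := by exact_mod_cast hV.card_pos
  induction n with
  | zero => simpa [convIter_zero] using hc
  | succ n ih =>
    intro x hx
    rw [convIter_succ, conv_unif, le_div_iff₀ hV']
    calc c * V.card = ∑ v ∈ V, c := by simp; ring
      _ ≤ _ := sum_le_sum fun v hv => ih _ (hX n x hx v hv)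

theorem convIter_unif_nonneg (V : Finset G) (n : ℕ) {f : G → ℝ} (hf : ∀ x, 0 ≤ f x) :
    ∀ x, 0 ≤ convIter (unif V) n f x := by
  induction n with
  | zero => exact hf
  | succ n ih => rw [convIter_succ]; exact conv_nonneg ih (unif_nonneg V)

theorem sum_convIter_unif {V : Finset G} (hV : V.Nonempty) (n : ℕ) (f : G → ℝ) :
    ∑ x, convIter (unif V) n f x = ∑ x, f x := by
  induction n with
  | zero => rfl
  | succ n ih => rw [convIter_succ, sum_conv, sum_unif hV, mul_one, ih]

/-- A weight adapted to dissociativity: μ_P convolved R times with μ_V. Each factor halves the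
relevant coefficients, giving 2^{-R}, while P is wide enough for the weight to keep the value 1/|P|
on all of Bohr(Γ, σ). A subset of exactly R characters then contradicts `card_le_log_of_riesz`. -/
theorem RelDissociated.card_lt {Γ : Finset (AddChar G ℂ)} {σ v : ℝ} (hσ : 0 ≤ σ) (hv : 0 ≤ v)
    {T : Finset G} (hT : T.Nonempty) (hTS : T ⊆ bohr Γ σ) {R : ℕ}
    (hR : 8 * Real.log (4 * ((bohr Γ σ).card / T.card)) < R)
    (hS : ((bohr Γ (σ + R * v)).card : ℝ) ≤ 2 * (bohr Γ σ).card)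
    {Λ : Finset (AddChar G ℂ)} (hΛ : RelDissociated (bohr Γ v) Λ)
    (hspec : ∀ χ ∈ Λ, 1 / 2 ≤ ‖dft (unif T) χ‖) : Λ.card < R := by
  classical
  by_contra! hcard
  obtain ⟨Λ', hsub, hcard'⟩ := exists_subset_card_eq hcard
  have hΛ' := hΛ.mono hsub
  have hVne : (bohr Γ v).Nonempty := ⟨0, zero_mem_bohr hv⟩
  set P := bohr Γ (σ + R * v) with hP
  have hRv : 0 ≤ R * v := by positivity
  have hPne : P.Nonempty := ⟨0, zero_mem_bohr (by linarith)⟩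
  have hPpos : (0 : ℝ) < P.card := by exact_mod_cast hPne.card_pos
  have hTpos : (0 : ℝ) < T.card := by exact_mod_cast hT.card_pos
  have hSpos : (0 : ℝ) < (bohr Γ σ).card := card_bohr_pos hσ
  set w := convIter (unif (bohr Γ v)) R (unif P) with hw
  have hw0 : ∀ x, 0 ≤ w x := convIter_unif_nonneg _ _ (unif_nonneg P)
  have hw1 : ∑ x, w x = 1 := by rw [hw, sum_convIter_unif hVne, sum_unif hPne]
  have hwS : ∀ x ∈ bohr Γ σ, 1 / (P.card : ℝ) ≤ w x := by
    intro x hx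
    refine le_convIter_unif hVne (X := fun n => bohr Γ (σ + (R - n) * v)) ?_ ?_ R x ?_
    · intro n y hy u hu
      have := sub_mem_bohr hy hu
      refine bohr_mono (le_of_eq ?_) this
      push_cast; ring
    · intro y hy
      have : y ∈ P := by simpa using hy
      rw [unif, ind_of_mem this]
    · simpa using hx
  have hTw : ∀ x, unif T x ≤ 2 * ((bohr Γ σ).card / T.card) * w x := by
    intro x
    by_cases hx : x ∈ T
    · rw [unif, ind_of_mem hx]
      have h1 := hwS x (hTS hx)
      have h2 : 1 / (2 * ((bohr Γ σ).card : ℝ)) ≤ w x :=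
        (one_div_le_one_div_of_le hPpos hS).trans h1
      calc (1 : ℝ) / T.card =
            2 * ((bohr Γ σ).card / T.card) * (1 / (2 * ((bohr Γ σ).card : ℝ))) := by
              field_simp
        _ ≤ _ := by gcongr
    · rw [unif, ind_of_notMem hx, zero_div]
      exact mul_nonneg (by positivity) (hw0 x)
  have key := card_le_log_of_riesz (ι := Λ') (fun i => i.1) hT (fun i => hspec i (hsub i.2)) hw0
    hw1.le (M := 2 * ((bohr Γ σ).card / T.card)) (by positivity) hTw (by
      intro e he hne
      rw [Fintype.card_coe, hcard', hw, dft_convIter, norm_mul, norm_pow]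
      have hprod : ∏ i : Λ', (i : AddChar G ℂ) ^ e i =
          ∏ χ ∈ Λ', χ ^ (if h : χ ∈ Λ' then e ⟨χ, h⟩ else 0) := by
        rw [← prod_coe_sort Λ']
        exact prod_congr rfl fun i _ => by simp
      have hd : ‖dft (unif (bohr Γ v)) (∏ i : Λ', (i : AddChar G ℂ) ^ e i)‖ ≤ 1 / 2 := by
        rw [hprod]
        refine hΛ' (fun χ => if h : χ ∈ Λ' then e ⟨χ, h⟩ else 0) (fun χ => ?_) ?_
        · by_cases hχ : χ ∈ Λ'
          · simpa [hχ] using he ⟨χ, hχ⟩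
          · simp [hχ]
        · obtain ⟨i, hi⟩ := Function.ne_iff.1 hne
          exact ⟨i, i.2, by simpa using hi⟩
      rw [← one_mul ((1 / 2 : ℝ) ^ R)]
      exact mul_le_mul (norm_dft_unif_le_one _ _) (pow_le_pow_left₀ (norm_nonneg _) hd R)
        (by positivity) zero_le_one)
  rw [Fintype.card_coe, hcard'] at key
  have : 2 * (2 * ((bohr Γ σ).card / T.card : ℝ)) = 4 * ((bohr Γ σ).card / T.card) := by ring
  rw [this] at key
  linarith

open Classical in
/-- Chang's theorem relative to a Bohr set: the large spectrum of a dense subset of a Bohr set is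
almost annihilated by a narrower Bohr set with few additional characters. -/
theorem exists_bohr_annihilating_spectrum {Γ : Finset (AddChar G ℂ)} {σ v : ℝ} (hσ : 0 ≤ σ)
    (hv : 0 ≤ v) (hreg : RegularRadius Γ v) {T : Finset G} (hT : T.Nonempty) (hTS : T ⊆ bohr Γ σ)
    {R : ℕ} (hR : 8 * Real.log (4 * ((bohr Γ σ).card / T.card)) < R)
    (hS : ((bohr Γ (σ + R * v)).card : ℝ) ≤ 2 * (bohr Γ σ).card) :
    ∃ Λ : Finset (AddChar G ℂ), Λ.card < R ∧ ∀ γ, 1 / 2 ≤ ‖dft (unif T) γ‖ →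
      ∀ κ ω : ℝ, 0 ≤ κ → 12 * (Γ.card : ℝ) * κ ≤ 1 → 0 ≤ ω → ω ≤ κ * v →
        ∀ x ∈ bohr (Γ ∪ Λ) ω, ‖γ x - 1‖ ≤ R * ω + 48 * Γ.card * κ := by
  set 𝒮 := (univ : Finset (AddChar G ℂ)).filter fun γ => 1 / 2 ≤ ‖dft (unif T) γ‖ with h𝒮
  have hne : (𝒮.powerset.filter fun Λ => RelDissociated (bohr Γ v) Λ).Nonempty :=
    ⟨∅, mem_filter.2 ⟨empty_mem_powerset _, fun e _ ⟨χ, hχ, _⟩ => absurd hχ (notMem_empty _)⟩⟩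
  obtain ⟨Λ, hΛ, hmax⟩ := exists_max_image _ card hne
  rw [mem_filter, mem_powerset] at hΛ
  have hcard : Λ.card < R := hΛ.2.card_lt hσ hv hT hTS hR hS fun χ hχ =>
    (mem_filter.1 (hΛ.1 hχ)).2
  refine ⟨Λ, hcard, fun γ hγ κ ω hκ hκ1 hω hωv x hx => ?_⟩
  have hxΛ : ∀ χ ∈ Λ, ‖χ x - 1‖ ≤ ω := fun χ hχ => mem_bohr.1 hx χ (mem_union_right _ hχ)
  have hR1 : (1 : ℝ) ≤ R := by exact_mod_cast (Nat.zero_le _).trans_lt hcard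
  by_cases hγΛ : γ ∈ Λ
  · have h1 := hxΛ γ hγΛ
    have h2 : 0 ≤ 48 * (Γ.card : ℝ) * κ := by positivity
    nlinarith
  -- Maximality of Λ: some product of γ^{±1} with a {-1, 0, 1}-combination ψ of Λ has a large
  -- coefficient on the Bohr set of radius v, so it is nearly 1 on a narrower one. There ψ is nearly
  -- 1 too, hence so is γ.
  have hnot : ¬ RelDissociated (bohr Γ v) (insert γ Λ) := by
    intro hd
    have := hmax (insert γ Λ) (mem_filter.2 ⟨mem_powerset.2 (insert_subset
      (mem_filter.2 ⟨mem_univ _, hγ⟩) hΛ.1), hd⟩)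
    rw [card_insert_of_notMem hγΛ] at this
    omega
  simp only [RelDissociated, not_forall, not_le] at hnot
  obtain ⟨e, he, hex, hlt⟩ := hnot
  rw [prod_insert hγΛ] at hlt
  have heγ : e γ ≠ 0 := by
    intro h0
    rw [h0, zpow_zero, one_mul] at hlt
    obtain ⟨χ, hχ, hχ0⟩ := hex
    rcases mem_insert.1 hχ with rfl | hχ'
    · exact hχ0 h0
    · exact absurd (hΛ.2 e he ⟨χ, hχ', hχ0⟩) (not_le.2 hlt)
  have hχx := norm_sub_one_le_of_half_lt hv hreg hκ hκ1 hlt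
    (bohr_mono hωv (bohr_anti subset_union_left hx))
  set ψ := ∏ χ ∈ Λ, χ ^ e χ with hψ
  have hψx : ‖ψ⁻¹ x - 1‖ ≤ R * ω := by
    rw [AddChar.inv_apply, norm_addChar_neg_sub_one]
    refine (norm_prod_apply_sub_one_le _ _ _).trans ?_
    calc ∑ χ ∈ Λ, ‖(χ ^ e χ) x - 1‖ ≤ ∑ χ ∈ Λ, ω := sum_le_sum fun χ hχ =>
          (norm_zpow_apply_sub_one_le χ x (he χ)).trans (hxΛ χ hχ)
      _ = Λ.card * ω := by simp
      _ ≤ R * ω := by gcongr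
  have hpow : ‖(γ ^ e γ) x - 1‖ = ‖γ x - 1‖ := by
    have := he γ
    simp only [mem_insert, mem_singleton] at this
    rcases this with h | h | h
    · rw [h, zpow_neg_one, AddChar.inv_apply, norm_addChar_neg_sub_one]
    · exact absurd h heγ
    · rw [h, zpow_one]
  rw [← hpow]
  have e1 : γ ^ e γ = γ ^ e γ * ψ * ψ⁻¹ := by rw [mul_inv_cancel_right]
  rw [e1]
  refine (norm_mul_apply_sub_one_le _ _ _).trans ?_
  linarith

end Spectrum

/-! ### Replacing averages over T - T by averages over a Bohr set. -/

section Smoothing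

variable {G : Type*} [AddCommGroup G] [Fintype G]

theorem sum_diffMeasure {T : Finset G} (hT : T.Nonempty) : ∑ x, diffMeasure T x = 1 := by
  have h : ∑ x, unif T (-x) = 1 := by
    rw [← sum_unif hT]
    exact Fintype.sum_equiv (Equiv.neg G) _ _ fun x => rfl
  rw [diffMeasure, sum_conv, sum_unif hT, h, one_mul]

/-- Used to pass from f to f + α, the function for which the sampling error is purely relative. -/
theorem convIter_add_const {ν : G → ℝ} (hν : ∑ x, ν x = 1) (f : G → ℝ) (a : ℝ) (n : ℕ) :
    convIter ν n (fun x => f x + a) = fun x => convIter ν n f x + a := by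
  induction n with
  | zero => rfl
  | succ n ih =>
    funext x
    rw [convIter_succ, convIter_succ, ih, conv_eq_sum_sub, conv_eq_sum_sub]
    simp only [mul_add, sum_add_distrib]
    rw [← sum_mul, hν, one_mul]

theorem norm_one_sub_dft_unif_le {M : Finset G} (hM : M.Nonempty) {γ : AddChar G ℂ} {ζ : ℝ}
    (h : ∀ x ∈ M, ‖γ x - 1‖ ≤ ζ) : ‖1 - dft (unif M) γ‖ ≤ ζ := by
  have hMpos : (0 : ℝ) < M.card := by exact_mod_cast hM.card_pos
  have hM0 : (M.card : ℂ) ≠ 0 := by exact_mod_cast hMpos.ne'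
  have e : 1 - dft (unif M) γ = -(∑ x ∈ M, (γ x - 1)) / M.card := by
    rw [dft_unif, dft_ind, sum_sub_distrib]
    simp only [sum_const, nsmul_eq_mul, mul_one]
    field_simp
    ring
  rw [e, norm_div, norm_neg, Complex.norm_natCast, div_le_iff₀ hMpos]
  refine (norm_sum_le _ _).trans ((sum_le_sum h).trans ?_)
  simp [mul_comm]

/-- Convolving further with `μ_M * μ_M` hardly changes `1_A * μ_A * (μ_T * μ_{-T})^{(l)}` if `M`
almost annihilates the large spectrum of `T`. -/
theorem abs_convIter_sub_conv_conv_le {A T M : Finset G} (hA : A.Nonempty)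
    (hM : M.Nonempty) {ζ ε : ℝ} {l : ℕ}
    (hspec : ∀ γ, 1 / 2 ≤ ‖dft (unif T) γ‖ → ∀ x ∈ M, ‖γ x - 1‖ ≤ ζ)
    (hl : 2 * (1 / 4 : ℝ) ^ l ≤ ε) (hζ : 2 * ζ ≤ ε) (x : G) :
    |convIter (diffMeasure T) l (conv (ind A) (unif A)) x -
      conv (conv (convIter (diffMeasure T) l (conv (ind A) (unif A))) (unif M)) (unif M) x| ≤ ε := by
  set F := convIter (diffMeasure T) l (conv (ind A) (unif A)) with hF
  refine abs_le_of_norm_dft_le hA (g := F - conv (conv F (unif M)) (unif M)) (fun γ => ?_) x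
  -- On the large spectrum 1 - dft (unif M) γ is at most ζ; off it the l-th power contributes
  -- (1/4)^l.
  have e : dft (F - conv (conv F (unif M)) (unif M)) γ =
      (dft (ind A) γ ^ 2 / A.card) * (dft (diffMeasure T) γ ^ l *
        ((1 - dft (unif M) γ) * (1 + dft (unif M) γ))) := by
    rw [dft_sub, dft_conv, dft_conv, hF, dft_convIter, dft_conv, dft_unif A]
    ring
  rw [e, norm_mul, norm_div, norm_pow, Complex.norm_natCast, mul_comm]
  refine mul_le_mul_of_nonneg_right ?_ (by positivity)
  rw [norm_mul, norm_pow, norm_mul, dft_diffMeasure, Complex.norm_real, Real.norm_eq_abs,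
    abs_of_nonneg (by positivity)]
  have h1 : ‖1 + dft (unif M) γ‖ ≤ 2 := by
    refine (norm_add_le _ _).trans ?_
    have := norm_dft_unif_le_one M γ
    rw [norm_one]; linarith
  have h2 : ‖1 - dft (unif M) γ‖ ≤ 2 := by
    refine (norm_sub_le _ _).trans ?_
    have := norm_dft_unif_le_one M γ
    rw [norm_one]; linarith
  have h3 := norm_dft_unif_le_one M γ
  have hT1 := norm_dft_unif_le_one T γ
  by_cases hγ : 1 / 2 ≤ ‖dft (unif T) γ‖
  · have h4 := norm_one_sub_dft_unif_le hM (hspec γ hγ)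
    have h5 : (‖dft (unif T) γ‖ ^ 2) ^ l ≤ 1 :=
      pow_le_one₀ (by positivity) (pow_le_one₀ (norm_nonneg _) hT1)
    calc _ ≤ 1 * (ζ * 2) := by gcongr; exact (norm_nonneg _).trans h4
      _ ≤ ε := by linarith
  · have h5 : (‖dft (unif T) γ‖ ^ 2) ^ l ≤ (1 / 4) ^ l := by
      refine pow_le_pow_left₀ (by positivity) ?_ l
      have := norm_nonneg (dft (unif T) γ)
      nlinarith
    have h6 : ‖1 - dft (unif M) γ‖ * ‖1 + dft (unif M) γ‖ ≤ 2 := by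
      rw [← norm_mul]
      have e2 : (1 - dft (unif M) γ) * (1 + dft (unif M) γ) = 1 - dft (unif M) γ ^ 2 := by ring
      rw [e2]
      refine (norm_sub_le _ _).trans ?_
      rw [norm_one, norm_pow]
      have := pow_le_one₀ (n := 2) (norm_nonneg _) h3
      linarith
    calc _ ≤ (1 / 4) ^ l * 2 := by gcongr
      _ ≤ ε := by linarith

/-- Smoothing by M may be done first, so that a lower bound for f * μ_M * μ_M survives the averaging
over T - T. -/
theorem conv_conv_convIter (ν f g : G → ℝ) (n : ℕ) :
    conv (conv (convIter ν n f) g) g = convIter ν n (conv (conv f g) g) := by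
  refine dft_injective fun γ => ?_
  simp only [dft_conv, dft_convIter]
  ring

theorem conv_conv_conv_unif (A : Finset G) (g : G → ℝ) (x : G) :
    conv (conv (conv (ind A) (unif A)) g) g x = conv (conv (ind A) g) (conv (ind A) g) x / A.card := by
  have : conv (conv (conv (ind A) (unif A)) g) g =
      fun x => (A.card : ℝ)⁻¹ * conv (conv (ind A) g) (conv (ind A) g) x := by
    refine dft_injective fun γ => ?_
    rw [dft_const_mul]
    simp only [dft_conv, dft_unif]
    push_cast
    ring
  rw [this]
  ring

/-- A function bounded by `m` and supported on `P`, whose mass is close to `m |P|`, has large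
self-convolution near the origin. -/
theorem le_conv_self {g : G → ℝ} {m : ℝ} (hg0 : ∀ x, 0 ≤ g x) (hgm : ∀ x, g x ≤ m) {P Q : Finset G}
    (hgP : ∀ x, x ∉ P → g x = 0) (hQP : Q ⊆ P) {x : G} (hx : ∀ y ∈ Q, x - y ∈ P) :
    m ^ 2 * Q.card - 2 * m * (m * P.card - ∑ y, g y) ≤ conv g g x := by
  have hm : 0 ≤ m := (hg0 0).trans (hgm 0)
  have hpt : ∀ y, m ^ 2 * ind Q y - m * (m * ind P y - g y) -
      m * (m * ind P (x - y) - g (x - y)) ≤ g y * g (x - y) := by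
    intro y
    have h1 : g y ≤ m * ind P y := by
      by_cases hy : y ∈ P
      · rw [ind_of_mem hy, mul_one]; exact hgm y
      · rw [hgP y hy, ind_of_notMem hy, mul_zero]
    have h2 : g (x - y) ≤ m * ind P (x - y) := by
      by_cases hy : x - y ∈ P
      · rw [ind_of_mem hy, mul_one]; exact hgm _
      · rw [hgP _ hy, ind_of_notMem hy, mul_zero]
    have h3 : ind Q y ≤ ind P y * ind P (x - y) := by
      by_cases hy : y ∈ Q
      · rw [ind_of_mem hy, ind_of_mem (hQP hy), ind_of_mem (hx y hy)]; norm_num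
      · rw [ind_of_notMem hy]; exact mul_nonneg (ind_nonneg _ _) (ind_nonneg _ _)
    have i1 := ind_le_one P y
    have i2 := ind_le_one P (x - y)
    -- On P the product of the two deficits is nonnegative, that is gg' ≥ m(g + g') - m². The terms
    -- `j2` and `j3` cover the points where y or x - y leaves P.
    have j1 : 0 ≤ (m * ind P y - g y) * (m * ind P (x - y) - g (x - y)) :=
      mul_nonneg (sub_nonneg.2 h1) (sub_nonneg.2 h2)
    have j2 : 0 ≤ m * (1 - ind P (x - y)) * (m * ind P y - g y) :=
      mul_nonneg (mul_nonneg hm (sub_nonneg.2 i2)) (sub_nonneg.2 h1)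
    have j3 : 0 ≤ m * (1 - ind P y) * (m * ind P (x - y) - g (x - y)) :=
      mul_nonneg (mul_nonneg hm (sub_nonneg.2 i1)) (sub_nonneg.2 h2)
    have j4 := mul_le_mul_of_nonneg_left h3 (sq_nonneg m)
    linarith
  have hflip : ∀ h : G → ℝ, ∑ y, h (x - y) = ∑ y, h y := fun h =>
    Fintype.sum_equiv (Equiv.subLeft x) _ _ fun y => rfl
  rw [conv]
  refine le_trans (le_of_eq ?_) (sum_le_sum fun y _ => hpt y)
  rw [sum_sub_distrib, sum_sub_distrib, ← mul_sum, ← mul_sum, ← mul_sum,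
    hflip fun z => m * ind P z - g z, sum_sub_distrib, ← mul_sum, sum_ind, sum_ind]
  ring

end Smoothing

/-! ### Densities on translates and counting progressions. -/

section Counting

variable {G : Type*} [AddCommGroup G]

/-- The part of `A - u` inside `V`. -/
noncomputable def translatePart (A V : Finset G) (u : G) : Finset G :=
  open Classical in V.filter fun y => u + y ∈ A

theorem mem_translatePart {A V : Finset G} {u y : G} :
    y ∈ translatePart A V u ↔ y ∈ V ∧ u + y ∈ A := by
  simp [translatePart]

variable [Fintype G]

theorem conv_unif_nonneg (A B : Finset G) (x : G) : 0 ≤ conv (ind A) (unif B) x :=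
  conv_nonneg (ind_nonneg A) (unif_nonneg B) x

theorem conv_unif_le_one (A B : Finset G) (x : G) : conv (ind A) (unif B) x ≤ 1 := by
  rw [conv_unif]
  refine div_le_one_of_le₀ ?_ (Nat.cast_nonneg _)
  calc ∑ a ∈ B, ind A (x - a) ≤ ∑ a ∈ B, (1 : ℝ) := sum_le_sum fun a _ => ind_le_one _ _
    _ = B.card := by simp

/-- The mean over a regular Bohr set of the density of `A` on translates of a narrower one. -/
theorem le_sum_conv_unif {Γ : Finset (AddChar G ℂ)} {ρ r κ : ℝ} (hreg : RegularRadius Γ ρ)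
    (hρ : 0 ≤ ρ) (hκ : 0 ≤ κ) (hκ1 : 12 * (Γ.card : ℝ) * κ ≤ 1) (hr : 0 ≤ r) (hrκ : r ≤ κ * ρ)
    {A : Finset G} (hA : A ⊆ bohr Γ ρ) :
    (A.card : ℝ) - 12 * Γ.card * κ * (bohr Γ ρ).card ≤
      ∑ x ∈ bohr Γ ρ, conv (ind A) (unif (bohr Γ r)) x := by
  classical
  set B := bohr Γ ρ with hB
  set V := bohr Γ r with hV
  have hVpos : (0 : ℝ) < V.card := card_bohr_pos hr
  -- Points of A in the inner set stay in B under any shift from V; by regularity only 12dκ|B|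
  -- points of A can be lost.
  set B₀ := bohr Γ ((1 - κ) * ρ) with hB₀
  have hB₀B : B₀ ⊆ B := bohr_mono (by
    have := mul_nonneg hκ hρ
    linarith)
  have hB₀c : (1 - 12 * (Γ.card : ℝ) * κ) * B.card ≤ B₀.card := hreg.le_card hκ hκ1 le_rfl
  have hAB₀ : (A.card : ℝ) - 12 * Γ.card * κ * B.card ≤ (A ∩ B₀).card := by
    have h1 : (A \ B₀).card ≤ (B \ B₀).card := card_le_card (sdiff_subset_sdiff hA Subset.rfl)
    have h2 := card_inter_add_card_sdiff A B₀
    have h3 := card_sdiff_add_card_eq_card hB₀B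
    have h1' : ((A \ B₀).card : ℝ) ≤ (B \ B₀).card := by exact_mod_cast h1
    have h2' : ((A ∩ B₀).card : ℝ) + (A \ B₀).card = A.card := by exact_mod_cast h2
    have h3' : ((B \ B₀).card : ℝ) + B₀.card = B.card := by exact_mod_cast h3
    linarith
  simp_rw [conv_unif]
  rw [← sum_div, le_div_iff₀ hVpos, sum_comm]
  have key : ∀ v ∈ V, (A.card : ℝ) - 12 * Γ.card * κ * B.card ≤ ∑ x ∈ B, ind A (x - v) := by
    intro v hv
    refine hAB₀.trans ?_
    have hsub : (A ∩ B₀).map (addRightEmbedding v) ⊆ B := by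
      intro y hy
      obtain ⟨a, ha, rfl⟩ := mem_map.1 hy
      refine bohr_mono ?_ (add_mem_bohr (mem_inter.1 ha).2 hv)
      linarith
    refine le_trans ?_ (sum_le_sum_of_subset_of_nonneg hsub fun _ _ _ => ind_nonneg _ _)
    rw [sum_map]
    simp only [addRightEmbedding_apply, add_sub_cancel_right]
    rw [sum_congr rfl fun a ha => ind_of_mem (mem_inter.1 ha).1]
    simp
  calc ((A.card : ℝ) - 12 * Γ.card * κ * B.card) * V.card =
        ∑ v ∈ V, ((A.card : ℝ) - 12 * Γ.card * κ * B.card) := by simp; ring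
    _ ≤ _ := sum_le_sum key

theorem card_translatePart {Γ : Finset (AddChar G ℂ)} {r : ℝ} (hr : 0 ≤ r) (A : Finset G) (u : G) :
    ((translatePart A (bohr Γ r) u).card : ℝ) =
      conv (ind A) (unif (bohr Γ r)) u * (bohr Γ r).card := by
  classical
  rw [conv_unif, div_mul_cancel₀ _ (card_bohr_pos hr).ne', translatePart, card_filter]
  push_cast
  refine sum_nbij' (fun y => -y) (fun y => -y) (fun y hy => neg_mem_bohr hy)
    (fun y hy => neg_mem_bohr hy) (fun y _ => neg_neg y) (fun y _ => neg_neg y) fun y _ => ?_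
  rw [sub_neg_eq_add]
  split_ifs with h
  · rw [ind_of_mem h]
  · rw [ind_of_notMem h]

theorem conv_translatePart_le (A V M : Finset G) (u x : G) :
    conv (ind (translatePart A V u)) (unif M) x ≤ conv (ind A) (unif M) (u + x) := by
  rw [conv_unif, conv_unif]
  refine div_le_div_of_nonneg_right (sum_le_sum fun a _ => ?_) (Nat.cast_nonneg _)
  by_cases h : x - a ∈ translatePart A V u
  · rw [ind_of_mem h, add_sub_assoc, ind_of_mem (mem_translatePart.1 h).2]
  · rw [ind_of_notMem h]; exact ind_nonneg _ _

/-- Pairs (b, a) with 2b - a in A₁ give the progressions u + a, u + b, u + 2b - a, and these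
determine the pair. -/
theorem card_mul_sum_conv_le_numAP (A V W : Finset G) (u : G) :
    ((translatePart A V u).card : ℝ) * ∑ b ∈ translatePart A W u,
      conv (ind (translatePart A V u)) (unif (translatePart A V u)) (2 • b) ≤ numAP A := by
  classical
  set A₁ := translatePart A V u with hA₁
  set A₂ := translatePart A W u with hA₂
  rcases A₁.eq_empty_or_nonempty with h0 | hne
  · rw [h0]; simp
  have hpos : (0 : ℝ) < A₁.card := by exact_mod_cast hne.card_pos
  have h1 : (A₁.card : ℝ) * ∑ b ∈ A₂, conv (ind A₁) (unif A₁) (2 • b) =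
      (((A₂ ×ˢ A₁).filter fun q => 2 • q.1 - q.2 ∈ A₁).card : ℝ) := by
    rw [card_filter, mul_sum, sum_product]
    push_cast
    refine sum_congr rfl fun b _ => ?_
    rw [conv_unif, mul_div_cancel₀ _ hpos.ne']
    refine sum_congr rfl fun a _ => ?_
    split_ifs with h
    · exact ind_of_mem h
    · exact ind_of_notMem h
  rw [h1, numAP, Nat.cast_le]
  refine card_le_card_of_injOn (fun q => (u + q.2, u + q.1, u + (2 • q.1 - q.2))) ?_ ?_
  · intro q hq
    simp only [coe_filter, Set.mem_ofPred_eq, mem_product] at hq ⊢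
    refine ⟨⟨(mem_translatePart.1 hq.1.2).2, (mem_translatePart.1 hq.1.1).2,
      (mem_translatePart.1 hq.2).2⟩, ?_⟩
    simp only [two_nsmul]
    abel
  · intro q _ q' _ h
    simp only [Prod.mk.injEq, add_right_inj] at h
    exact Prod.ext h.2.1 h.1

end Counting

/-! ### Choice of the numerical parameters. -/

section Parameters

theorem log_two_div_bounds {α : ℝ} (hα : 0 < α) (hα1 : α ≤ 1) :
    69 / 100 ≤ Real.log (2 / α) ∧ Real.log (2 / α) ≤ 2 / α := by
  constructor
  · have h1 := Real.log_two_gt_d9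
    have h2 : Real.log 2 ≤ Real.log (2 / α) := by
      refine Real.log_le_log (by norm_num) ?_
      rw [le_div_iff₀ hα]
      linarith
    linarith
  · have := Real.log_le_sub_one_of_pos (show 0 < 2 / α by positivity)
    linarith

/-- The number of convolution factors. -/
theorem exists_numFactors {α : ℝ} (hα : 0 < α) (hα1 : α ≤ 1) :
    ∃ l : ℕ, 1 ≤ l ∧ (l : ℝ) ≤ 10 * Real.log (2 / α) ∧ 2 * (1 / 4 : ℝ) ^ l ≤ α / 20 := by
  obtain ⟨hL, -⟩ := log_two_div_bounds hα hα1
  set L := Real.log (2 / α) with hLdef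
  have hle := Nat.le_ceil (8 * L)
  have hlt := Nat.ceil_lt_add_one (show 0 ≤ 8 * L by linarith)
  refine ⟨⌈8 * L⌉₊, Nat.one_le_ceil_iff.2 (by linarith), by linarith, ?_⟩
  have h1 : (1 / 4 : ℝ) ≤ Real.exp (-1) := by
    rw [Real.exp_neg, one_div]
    refine inv_anti₀ (Real.exp_pos _) ?_
    linarith [Real.exp_one_lt_d9]
  have h2 : (1 / 4 : ℝ) ^ ⌈8 * L⌉₊ ≤ Real.exp (-(8 * L)) := by
    calc (1 / 4 : ℝ) ^ ⌈8 * L⌉₊ ≤ Real.exp (-1) ^ ⌈8 * L⌉₊ := by gcongr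
      _ = Real.exp (-(⌈8 * L⌉₊ : ℝ)) := by rw [← Real.exp_nat_mul]; congr 1; ring
      _ ≤ _ := Real.exp_le_exp.2 (by linarith)
  have h3 : Real.exp (-(8 * L)) = (α / 2) ^ 8 := by
    have : -(8 * L) = ((8 : ℕ) : ℝ) * -L := by push_cast; ring
    rw [this, Real.exp_nat_mul, Real.exp_neg, hLdef, Real.exp_log (by positivity), inv_div]
  rw [h3] at h2
  have h4 : (α / 2) ^ 8 ≤ α / 256 := by
    have : α ^ 8 ≤ α := by
      calc α ^ 8 ≤ α ^ 1 := pow_le_pow_of_le_one hα.le hα1 (by norm_num)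
        _ = α := pow_one α
    have e : (α / 2) ^ 8 = α ^ 8 / 256 := by ring
    rw [e]; gcongr
  linarith

/-- The number of samples and the bound for the rank. -/
theorem exists_numSamples {α : ℝ} (hα : 0 < α) (hα1 : α ≤ 1) {l : ℕ} (hl1 : 1 ≤ l)
    (hl : (l : ℝ) ≤ 10 * Real.log (2 / α)) :
    ∃ k R : ℕ, 0 < k ∧ 1 ≤ R ∧
      2 * Real.exp (-(k * ((1 / (60 * l : ℝ)) ^ 2 * α))) ≤ α ^ 2 / (1000 * l) / 2 ∧
      8 * Real.log (4 * (2 * (3 / α) ^ k)) < R ∧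
      (R : ℝ) ≤ 3 * 10 ^ 8 * α⁻¹ * Real.log (2 / α) ^ 4 := by
  obtain ⟨hL, hL2⟩ := log_two_div_bounds hα hα1
  set L := Real.log (2 / α) with hLdef
  have hl' : (1 : ℝ) ≤ l := by exact_mod_cast hl1
  have hexpL : Real.exp (-L) = α / 2 := by
    rw [Real.exp_neg, hLdef, Real.exp_log (by positivity), inv_div]
  -- With δ = 1/(60l) this makes kδ²α at least 17 log(2/α), so the failure probability is at most
  -- 2(α/2)^17, below half of β = α²/(1000l).
  set y : ℝ := 17 * L * (60 * l) ^ 2 * α⁻¹ with hy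
  have hαi : 1 ≤ α⁻¹ := (one_le_inv₀ hα).2 hα1
  have hy0 : 0 < y := by positivity
  have hk1 := Nat.le_ceil y
  have hk2 := Nat.ceil_lt_add_one hy0.le
  set k := ⌈y⌉₊ with hk
  have hkpos : 0 < k := Nat.ceil_pos.2 hy0
  have hk' : (1 : ℝ) ≤ k := by exact_mod_cast hkpos
  have hL3 : 3 / 10 ≤ L ^ 3 := by
    calc (3 / 10 : ℝ) ≤ (69 / 100) ^ 3 := by norm_num
      _ ≤ L ^ 3 := by gcongr
  have hkle : (k : ℝ) ≤ 7 * 10 ^ 6 * α⁻¹ * L ^ 3 := by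
    have h1 : y ≤ 17 * L * (60 * (10 * L)) ^ 2 * α⁻¹ := by
      rw [hy]; gcongr
    have h2 : 3 / 10 ≤ α⁻¹ * L ^ 3 := by nlinarith
    have e : 17 * L * (60 * (10 * L)) ^ 2 * α⁻¹ = 6120000 * (α⁻¹ * L ^ 3) := by ring
    rw [e] at h1
    linarith
  have hz1 := Nat.le_ceil (40 * k * L)
  have hz2 := Nat.ceil_lt_add_one (show 0 ≤ 40 * k * L by positivity)
  -- The logarithm to be beaten is at most 3L + 2kL ≤ 5kL, and 8 · 5 = 40; the extra 1 makes the
  -- inequality strict.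
  refine ⟨k, ⌈40 * k * L⌉₊ + 1, hkpos, by omega, ?_, ?_, ?_⟩
  · have h1 : 17 * L ≤ k * ((1 / (60 * l : ℝ)) ^ 2 * α) := by
      have : 17 * L = y * ((1 / (60 * l : ℝ)) ^ 2 * α) := by
        rw [hy]; field_simp
      rw [this]; gcongr
    have h2 : Real.exp (-(k * ((1 / (60 * l : ℝ)) ^ 2 * α))) ≤ (α / 2) ^ 17 := by
      calc _ ≤ Real.exp (-(17 * L)) := Real.exp_le_exp.2 (by linarith)
        _ = (α / 2) ^ 17 := by
          have : -(17 * L) = ((17 : ℕ) : ℝ) * -L := by push_cast; ring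
          rw [this, Real.exp_nat_mul, hexpL]
    have h3 : α ^ 17 ≤ α ^ 3 := pow_le_pow_of_le_one hα.le hα1 (by norm_num)
    have h4 : (l : ℝ) * α ≤ 20 := by
      have : (l : ℝ) ≤ 10 * (2 / α) := hl.trans (by gcongr)
      calc (l : ℝ) * α ≤ 10 * (2 / α) * α := by gcongr
        _ = 20 := by field_simp; norm_num
    have h5 : α ^ 3 / 131072 * 4 ≤ α ^ 2 / (1000 * l) := by
      rw [le_div_iff₀ (by positivity)]
      have : 0 ≤ α ^ 2 := by positivity
      nlinarith
    have e : (α / 2) ^ 17 = α ^ 17 / 131072 := by ring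
    rw [e] at h2
    linarith
  · have h1 : Real.log (3 / α) ≤ 2 * L := by
      have : Real.log (3 / α) ≤ Real.log ((2 / α) ^ 2) := by
        refine Real.log_le_log (by positivity) ?_
        rw [div_pow, div_le_div_iff₀ hα (by positivity)]
        nlinarith
      rwa [Real.log_pow, Nat.cast_ofNat, ← hLdef] at this
    have h2 : Real.log 8 ≤ 3 * L := by
      have : Real.log 8 ≤ Real.log ((2 / α) ^ 3) := by
        refine Real.log_le_log (by positivity) ?_
        have : (2 : ℝ) ≤ 2 / α := by rw [le_div_iff₀ hα]; linarith
        calc (8 : ℝ) = 2 ^ 3 := by norm_num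
          _ ≤ _ := by gcongr
      rwa [Real.log_pow, Nat.cast_ofNat, ← hLdef] at this
    have e : 4 * (2 * (3 / α) ^ k) = 8 * (3 / α) ^ k := by ring
    rw [e, Real.log_mul (by norm_num) (by positivity), Real.log_pow]
    push_cast
    have h3 : (k : ℝ) * Real.log (3 / α) ≤ k * (2 * L) := by gcongr
    have h4 : 3 * L ≤ 3 * (k * L) := by nlinarith
    linarith
  · push_cast
    have h1 : 40 * (k : ℝ) * L ≤ 40 * (7 * 10 ^ 6 * α⁻¹ * L ^ 3) * L := by gcongr
    have h2 : 2 / 10 ≤ α⁻¹ * L ^ 4 := by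
      have : 2 / 10 ≤ L ^ 4 := by
        calc (2 / 10 : ℝ) ≤ (69 / 100) ^ 4 := by norm_num
          _ ≤ L ^ 4 := by gcongr
      nlinarith
    have e : 40 * (7 * 10 ^ 6 * α⁻¹ * L ^ 3) * L = 280000000 * (α⁻¹ * L ^ 4) := by ring
    rw [e] at h1
    linarith

theorem one_add_three_mul_pow_le {l : ℕ} (hl : 1 ≤ l) :
    (1 + 3 * (1 / (60 * l : ℝ))) ^ l ≤ 53 / 50 := by
  have hl' : (0 : ℝ) < l := by exact_mod_cast hl
  have h1 : (1 + 3 * (1 / (60 * l : ℝ))) ≤ Real.exp (1 / (20 * l)) := by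
    have := Real.add_one_le_exp (1 / (20 * l : ℝ))
    have e : 3 * (1 / (60 * l : ℝ)) = 1 / (20 * l) := by field_simp; norm_num
    rw [e]; linarith
  calc _ ≤ Real.exp (1 / (20 * l)) ^ l := by gcongr
    _ = Real.exp (1 / 20) := by rw [← Real.exp_nat_mul]; congr 1; field_simp
    _ ≤ 53 / 50 := by
      have := (abs_le.1 (Real.abs_exp_sub_one_sub_id_le (x := 1 / 20) (by norm_num [abs_le]))).2
      linarith

end Parameters

/-! ### Few progressions force a density increment. -/

section Increment

variable {G : Type*} [AddCommGroup G] [Fintype G]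

/-- If `1_A * μ_M` is bounded by `9α/8`, then `1_A * μ_A * μ_M * μ_M` is at least `α/2` near the
origin. -/
theorem half_le_conv_conv {Γ : Finset (AddChar G ℂ)} {r₁ r₂ κ α : ℝ} (hr₁ : 0 ≤ r₁)
    (hr₂ : 0 ≤ r₂) (hreg : RegularRadius Γ r₁) (hκ : 0 ≤ κ)
    (hκ1 : 12 * (Γ.card : ℝ) * (6 * κ) ≤ 1 / 64) (hr : r₂ ≤ κ * r₁) (hα : 0 < α)
    {A M : Finset G} (hA : A ⊆ bohr Γ r₁) (hAc : 13 / 16 * α * (bohr Γ r₁).card ≤ A.card)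
    (hMn : M.Nonempty) (hM : M ⊆ bohr Γ (2 * r₂))
    (hup : ∀ x, conv (ind A) (unif M) x < 9 / 8 * α) {x : G} (hx : x ∈ bohr Γ (4 * r₂)) :
    α / 2 ≤ conv (conv (conv (ind A) (unif A)) (unif M)) (unif M) x := by
  set B := bohr Γ r₁ with hB
  have hBpos : (0 : ℝ) < B.card := card_bohr_pos hr₁
  have hApos : (0 : ℝ) < A.card := lt_of_lt_of_le (by positivity) hAc
  set P := bohr Γ (r₁ + 6 * r₂) with hP
  have hPc : (P.card : ℝ) ≤ 65 / 64 * B.card := by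
    have := hreg.card_le (κ := 6 * κ) (σ := r₁ + 6 * r₂) (by linarith) (by linarith) (by linarith)
    refine this.trans ?_
    gcongr
    linarith
  have hsum : ∑ y, conv (ind A) (unif M) y = A.card := by
    rw [sum_conv, sum_ind, sum_unif hMn, mul_one]
  have hsupp : ∀ y, y ∉ P → conv (ind A) (unif M) y = 0 := by
    intro y hy
    rw [conv_unif, sum_eq_zero, zero_div]
    intro m hm
    refine ind_of_notMem fun hmem => hy ?_
    have := add_mem_bohr (hA hmem) (hM hm)
    rw [sub_add_cancel] at this
    exact bohr_mono (by linarith) this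
  have key := le_conv_self (fun y => conv_unif_nonneg A M y) (fun y => (hup y).le) hsupp
    (bohr_mono (by linarith) : B ⊆ P) (x := x) (fun y hy => by
      have := sub_mem_bohr hx hy
      exact bohr_mono (by linarith) this)
  rw [hsum] at key
  rw [conv_conv_conv_unif, le_div_iff₀ hApos]
  refine le_trans ?_ key
  -- With m = 9α/8 the claim reduces to m²(2 · 65/64 - 1) ≤ (9/4 - 1/2) · (13/16) α², which is where
  -- 13/16 is balanced against 9/8.
  have h1 := mul_le_mul_of_nonneg_left hPc (sq_nonneg α)
  have h2 := mul_le_mul_of_nonneg_left hAc hα.le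
  have h3 : 0 ≤ α ^ 2 * (B.card : ℝ) := by positivity
  rw [← hB]
  linarith

set_option maxHeartbeats 1000000 in
open Classical in
/-- The density increment in the absence of progressions. -/
theorem exists_increment (hG : Odd (Fintype.card G)) {Γ : Finset (AddChar G ℂ)}
    (hΓ : 1 ≤ Γ.card) {r₁ r₂ κ α : ℝ} (hr₁ : 0 ≤ r₁) (hr₂ : 0 ≤ r₂) (hr₂2 : r₂ ≤ 2)
    (hreg₁ : RegularRadius Γ r₁) (hreg₂ : RegularRadius Γ r₂) (hκ : 0 ≤ κ)
    (hκ1 : 12 * (Γ.card : ℝ) * (6 * κ) ≤ 1 / 64) (hr : r₂ ≤ κ * r₁) (hα : 0 < α) (hα1 : α ≤ 1)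
    {A₁ A₂ : Finset G} (hA₁ : A₁ ⊆ bohr Γ r₁) (hA₂ : A₂ ⊆ bohr Γ r₂)
    (hA₁c : 13 / 16 * α * (bohr Γ r₁).card ≤ A₁.card)
    (hA₂c : 13 / 16 * α * (bohr Γ r₂).card ≤ A₂.card)
    (hfew : ∑ b ∈ A₂, conv (ind A₁) (unif A₁) (2 • b) ≤ α / 100 * A₂.card) :
    ∃ (Δ : Finset (AddChar G ℂ)) (ω : ℝ), 0 ≤ ω ∧ ω ≤ r₂ ∧ halfFreq Γ ⊆ Δ ∧ RegularRadius Δ ω ∧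
      (Δ.card : ℝ) ≤ Γ.card + 3 * 10 ^ 8 * α⁻¹ * Real.log (2 / α) ^ 4 ∧
      α ^ 12 * r₂ / (10 ^ 29 * (Γ.card : ℝ) ^ 3) ≤ ω ∧
      ∃ x, 9 / 8 * α ≤ conv (ind A₁) (unif (bohr Δ ω)) x := by
  obtain ⟨hL, hL2⟩ := log_two_div_bounds hα hα1
  obtain ⟨l, hl1, hlL, hl4⟩ := exists_numFactors hα hα1
  obtain ⟨k, R, hk, hR1, hkβ, hRlog, hRle⟩ := exists_numSamples hα hα1 hl1 hlL
  set L := Real.log (2 / α) with hLdef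
  have hl' : (1 : ℝ) ≤ l := by exact_mod_cast hl1
  have hR' : (1 : ℝ) ≤ R := by exact_mod_cast hR1
  set d : ℝ := (Γ.card : ℝ) with hd
  have hd1 : 1 ≤ d := by rw [hd]; exact_mod_cast hΓ
  have hΓ' : 1 ≤ (halfFreq Γ).card := by rwa [card_halfFreq hG]
  have hdhalf : ((halfFreq Γ).card : ℝ) = d := by rw [card_halfFreq hG]
  have hreg₂' := hreg₂.halfFreq hG
  have hB₁pos : (0 : ℝ) < (bohr Γ r₁).card := card_bohr_pos hr₁
  have hA₁pos : (0 : ℝ) < A₁.card := lt_of_lt_of_le (by positivity) hA₁c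
  have hA₁ne : A₁.Nonempty := card_pos.1 (by exact_mod_cast hA₁pos)
  have hB₂pos : (0 : ℝ) < (bohr Γ r₂).card := card_bohr_pos hr₂
  have hA₂pos : (0 : ℝ) < A₂.card := lt_of_lt_of_le (by positivity) hA₂c
  -- the set of shifts
  obtain ⟨σ, hσ1, hσ2, hregσ⟩ := exists_regularRadius hΓ' (ρ := r₂ / (24 * d * l)) (by positivity)
  have hσ0 : 0 ≤ σ := le_trans (by positivity) hσ1
  have hσl : 2 * l * σ ≤ 1 / (12 * d) * r₂ := by
    calc 2 * l * σ ≤ 2 * l * (r₂ / (24 * d * l)) := by gcongr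
      _ = 1 / (12 * d) * r₂ := by field_simp; ring
  have h12d : 12 * d * (1 / (12 * d)) = 1 := by field_simp
  have hd12 : 1 / (12 * d) ≤ 1 := by
    rw [div_le_one (by positivity)]; linarith
  have hσr : 2 * l * σ ≤ r₂ := hσl.trans (mul_le_of_le_one_left hr₂ hd12)
  have hσr₂ : 2 * σ ≤ r₂ := by
    have := mul_le_mul_of_nonneg_right hl' hσ0
    linarith
  set S := bohr (halfFreq Γ) σ with hS
  have hSpos : (0 : ℝ) < S.card := card_bohr_pos hσ0
  -- Room for l - n shifts from S - S. In total they enlarge the radius by at most r₂/(12d), so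
  -- regularity keeps |X 0| within a factor 2.
  set X : ℕ → Finset G := fun n => bohr (halfFreq Γ) (r₂ + 2 * (l - n) * σ) with hX
  have hXc : ((X 0).card : ℝ) ≤ 2 * (bohr (halfFreq Γ) r₂).card := by
    have := hreg₂'.card_le (κ := 1 / (12 * d)) (σ := r₂ + 2 * (l - (0 : ℕ)) * σ) (by positivity)
      (by rw [hdhalf, h12d]) (by push_cast; linarith)
    rw [hdhalf, h12d] at this
    refine this.trans (le_of_eq ?_)
    norm_num
  have hXl : X l = bohr (halfFreq Γ) r₂ := by simp [hX]
  have hX0 : ∀ n, X n ⊆ X 0 := fun n => bohr_mono (by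
    have : 0 ≤ 2 * (n : ℝ) * σ := by positivity
    push_cast; linarith)
  have hXn : ∀ n, ∀ x ∈ X (n + 1), ∀ s ∈ S, ∀ s' ∈ S, x + (s - s') ∈ X n := by
    intro n x hx s hs s' hs'
    refine bohr_mono (le_of_eq ?_) (add_mem_bohr hx (sub_mem_bohr hs hs'))
    push_cast; ring
  have hXne : (X 0).Nonempty := ⟨0, hX0 l (by rw [hXl]; exact zero_mem_bohr hr₂)⟩
  -- almost periods
  set f := conv (ind A₁) (unif A₁) with hf
  have hβ : 0 < α ^ 2 / (1000 * l) := by positivity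
  have hδ0 : (0 : ℝ) ≤ 1 / (60 * l) := by positivity
  have hδ1 : (1 : ℝ) / (60 * l) ≤ 1 / 3 := by
    refine one_div_le_one_div_of_le (by norm_num) ?_
    linarith
  have hASc : ((bohr Γ (r₁ + r₂)).card : ℝ) ≤ 3 / α * A₁.card := by
    have h1 := hreg₁.card_le (κ := 6 * κ) (σ := r₁ + r₂) (by linarith) (by linarith) (by
      have := mul_nonneg hκ hr₁
      linarith)
    have h2 : ((bohr Γ (r₁ + r₂)).card : ℝ) ≤ 65 / 64 * (bohr Γ r₁).card := by
      refine h1.trans ?_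
      gcongr
      linarith
    rw [div_mul_eq_mul_div, le_div_iff₀ hα]
    have h3 := mul_le_mul_of_nonneg_right h2 hα.le
    have h4 := mul_pos hα hB₁pos
    linarith
  obtain ⟨T, hTS, hTc, g, hg⟩ := exists_almostPeriods (S := S) hA₁ne hXne (α := α) hβ hδ0
    (hδ1.trans (by norm_num)) hk hkβ (AS := bohr Γ (r₁ + r₂)) (fun a ha s hs => by
      refine add_mem_bohr (hA₁ ha) (bohr_mono ?_ (bohr_halfFreq_subset hG Γ σ hs))
      linarith) hASc
  have hTpos : (0 : ℝ) < T.card := by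
    rcases Nat.eq_zero_or_pos T.card with h0 | h0
    · rw [h0] at hTc
      simp only [CharP.cast_eq_zero, mul_zero] at hTc
      linarith
    · exact_mod_cast h0
  have hTne : T.Nonempty := card_pos.1 (by exact_mod_cast hTpos)
  have hXT : ∀ n, ∀ x ∈ X (n + 1), ∀ s ∈ T, ∀ s' ∈ T, x + (s - s') ∈ X n :=
    fun n x hx s hs s' hs' => hXn n x hx s (hTS hs) s' (hTS hs')
  -- R v ≤ σ/(12d), so R summands from the set of radius v at most double S, as Chang's theorem
  -- requires.
  obtain ⟨v, hv1, hv2, hregv⟩ := exists_regularRadius hΓ' (ρ := σ / (12 * d * R)) (by positivity)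
  have hv0 : 0 ≤ v := le_trans (by positivity) hv1
  have hvR : R * v ≤ 1 / (12 * d) * σ := by
    calc R * v ≤ R * (σ / (12 * d * R)) := by gcongr
      _ = 1 / (12 * d) * σ := by field_simp
  have hvσ : v ≤ σ := by
    have h1 : v ≤ R * v := le_mul_of_one_le_left hv0 hR'
    exact h1.trans (hvR.trans (mul_le_of_le_one_left hσ0 hd12))
  obtain ⟨Λ, hΛc, hΛ⟩ := exists_bohr_annihilating_spectrum (R := R) hσ0 hv0 hregv hTne hTS
    (by
      refine lt_of_le_of_lt ?_ hRlog
      have h1 : (S.card : ℝ) / T.card ≤ 2 * (3 / α) ^ k := by rwa [div_le_iff₀ hTpos]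
      gcongr)
    (by
      have := hregσ.card_le (κ := 1 / (12 * d)) (σ := σ + R * v) (by positivity)
        (by rw [hdhalf, h12d]) (by linarith)
      rw [hdhalf, h12d] at this
      refine this.trans (le_of_eq ?_)
      norm_num)
  set Δ := halfFreq Γ ∪ Λ with hΔ
  have hΔ1 : 1 ≤ Δ.card := hΓ'.trans (card_le_card subset_union_left)
  -- Makes Rω + 48dκ' at most α/2000 + 48α/4000, below α/40; the bound on Rω is where `r₂ ≤ 2`
  -- enters.
  set κ' : ℝ := α / (4000 * d * R) with hκ'
  have hκ'0 : 0 ≤ κ' := by positivity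
  obtain ⟨ω, hω1, hω2, hregω⟩ := exists_regularRadius hΔ1 (ρ := κ' * v) (by positivity)
  have hω0 : 0 ≤ ω := le_trans (by positivity) hω1
  have hκ'1 : κ' ≤ α / 4000 := by
    refine div_le_div_of_nonneg_left hα.le (by norm_num) ?_
    have := one_le_mul_of_one_le_of_one_le hd1 hR'
    linarith
  have hωv : ω ≤ v := hω2.trans (mul_le_of_le_one_left hv0 (by linarith))
  have hωr : 2 * ω ≤ r₂ := by linarith
  have hdκ' : d * κ' ≤ α / 4000 := by
    have e : d * κ' = α / 4000 / R := by rw [hκ']; field_simp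
    rw [e]
    exact div_le_self (by positivity) hR'
  have hRω : R * ω ≤ α / 2000 := by
    have hv2' : v ≤ 2 := by linarith
    have h1 : R * κ' ≤ α / 4000 := by
      have e : R * κ' = α / 4000 / d := by rw [hκ']; field_simp
      rw [e]
      exact div_le_self (by positivity) hd1
    calc R * ω ≤ R * (κ' * v) := by gcongr
      _ = R * κ' * v := by ring
      _ ≤ α / 4000 * 2 := by gcongr
      _ = α / 2000 := by ring
  set M := bohr Δ ω with hM
  have hMne : M.Nonempty := ⟨0, zero_mem_bohr hω0⟩
  have hMspec : ∀ γ, 1 / 2 ≤ ‖dft (unif T) γ‖ → ∀ x ∈ M, ‖γ x - 1‖ ≤ α / 40 := by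
    intro γ hγ x hx
    have := hΛ γ hγ κ' ω hκ'0 (by rw [hdhalf]; linarith) hω0 hω2 x hx
    rw [hdhalf] at this
    linarith
  refine ⟨Δ, ω, hω0, by linarith, subset_union_left, hregω, ?_, ?_, ?_⟩
  · have h1 : (Δ.card : ℝ) ≤ (halfFreq Γ).card + Λ.card := by exact_mod_cast card_union_le _ _
    have h2 : (Λ.card : ℝ) ≤ R := by exact_mod_cast hΛc.le
    rw [hdhalf] at h1
    linarith
  · have hRα : R * α ^ 5 ≤ 48 * 10 ^ 8 := by
      have hL4 : L ^ 4 ≤ (2 / α) ^ 4 := by gcongr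
      calc R * α ^ 5 ≤ 3 * 10 ^ 8 * α⁻¹ * (2 / α) ^ 4 * α ^ 5 := by
            gcongr
            exact hRle.trans (by gcongr)
        _ = 48 * 10 ^ 8 := by field_simp; norm_num
    have hlα : l * α ≤ 20 := by
      calc l * α ≤ 10 * (2 / α) * α := by
            gcongr
            exact hlL.trans (by gcongr)
        _ = 20 := by field_simp; norm_num
    have hprod : (R : ℝ) ^ 2 * l * α ^ 11 ≤ (48 * 10 ^ 8) ^ 2 * 20 := by
      calc (R : ℝ) ^ 2 * l * α ^ 11 = (R * α ^ 5) ^ 2 * (l * α) := by ring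
        _ ≤ (48 * 10 ^ 8) ^ 2 * 20 := by gcongr
    -- 73728000 = 24 · 12 · 4000 · 4³, one factor 4 for each of the three regularisations.
    have hchain : α * r₂ / (73728000 * d ^ 3 * (R ^ 2 * l)) ≤ ω := by
      calc α * r₂ / (73728000 * d ^ 3 * (R ^ 2 * l)) =
            κ' * (r₂ / (24 * d * l) / 4 / (12 * d * R) / 4) / 4 := by
              rw [hκ']; field_simp; ring
        _ ≤ κ' * (σ / (12 * d * R) / 4) / 4 := by gcongr
        _ ≤ κ' * v / 4 := by gcongr
        _ ≤ ω := hω1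
    refine le_trans ?_ hchain
    rw [div_le_div_iff₀ (by positivity) (by positivity)]
    have h0 : 0 ≤ α * r₂ * d ^ 3 := by positivity
    have h1 := mul_le_mul_of_nonneg_left hprod h0
    calc α ^ 12 * r₂ * (73728000 * d ^ 3 * (R ^ 2 * l)) =
          73728000 * (α * r₂ * d ^ 3 * (R ^ 2 * l * α ^ 11)) := by ring
      _ ≤ 73728000 * (α * r₂ * d ^ 3 * ((48 * 10 ^ 8) ^ 2 * 20)) := by gcongr
      _ ≤ α * r₂ * (10 ^ 29 * d ^ 3) := by linarith
  · by_contra! hup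
    have hMsub : M ⊆ bohr Γ (2 * r₂) := fun x hx =>
      bohr_mono (by linarith) (bohr_halfFreq_subset hG Γ ω (bohr_anti subset_union_left hx))
    have hlow : ∀ x ∈ X 0, α / 2 ≤ conv (conv f (unif M)) (unif M) x := by
      intro x hx
      refine half_le_conv_conv hr₁ hr₂ hreg₁ hκ hκ1 hr hα hA₁ hA₁c hMne hMsub hup ?_
      refine bohr_mono ?_ (bohr_halfFreq_subset hG Γ _ hx)
      push_cast; linarith
    have hlow2 := le_convIter_diffMeasure hTne hXT hlow l
    rw [← conv_conv_convIter, hXl] at hlow2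
    have hlow3 : ∀ x ∈ bohr (halfFreq Γ) r₂, 2 / 5 * α ≤ convIter (diffMeasure T) l f x := by
      intro x hx
      have h1 := hlow2 x hx
      have h2 := abs_convIter_sub_conv_conv_le hA₁ne hMne hMspec hl4 (by linarith) x
      have h3 := (abs_le.1 h2).1
      linarith
    -- averages over the doubled set
    set E := A₂.map ⟨fun x : G => 2 • x, (two_nsmul_bijective hG).1⟩ with hE
    have hEc : (E.card : ℝ) = A₂.card := by rw [hE, card_map]
    have hED : E ⊆ X l := by
      intro y hy
      obtain ⟨b, hb, rfl⟩ := mem_map.1 hy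
      rw [hXl]
      exact (two_nsmul_mem_bohr_halfFreq hG).2 (hA₂ hb)
    have hEf : ∑ x ∈ E, f x ≤ α / 100 * E.card := by
      rw [hEc, hE, sum_map]; exact hfew
    -- For u = f + α the error δ(α + f) becomes the relative error δu.
    have hup2 := sum_convIter_le_of_almostPeriods hTne hX0 hXT (u := fun x => f x + α)
      (g := fun x => g x + α) (M := 2) hδ0 hδ1 hβ.le
      (fun x => add_nonneg (conv_unif_nonneg _ _ x) hα.le)
      (fun x => by linarith [conv_unif_le_one A₁ A₁ x])
      (fun s hs => by
        refine le_trans ?_ (hg s hs)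
        rw [Nat.cast_le]
        refine card_le_card fun x hx => ?_
        rw [mem_filter] at hx ⊢
        refine ⟨hx.1, fun habs => hx.2 ?_⟩
        obtain ⟨h1, h2⟩ := abs_le.1 habs
        constructor <;> linarith) l E hED
    rw [convIter_add_const (sum_diffMeasure hTne)] at hup2
    rw [sum_add_distrib, sum_add_distrib] at hup2
    simp only [sum_const, nsmul_eq_mul] at hup2
    have hElow : E.card * (2 / 5 * α) ≤ ∑ x ∈ E, convIter (diffMeasure T) l f x := by
      rw [← nsmul_eq_mul]
      exact card_nsmul_le_sum _ _ _ fun x hx => hlow3 x (by rw [← hXl]; exact hED hx)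
    -- The choice of β is tuned here: the exceptional sets contribute α²|X 0|/250 ≤ α²|B₂|/125,
    -- within α|E|/100.
    have herr : l * (2 * (α ^ 2 / (1000 * l)) * (X 0).card * 2) ≤ α / 100 * E.card := by
      have e : l * (2 * (α ^ 2 / (1000 * l)) * (X 0).card * 2) = α ^ 2 / 250 * (X 0).card := by
        field_simp; norm_num
      rw [e, hEc]
      have h1 : α ^ 2 / 250 * (X 0).card ≤ α ^ 2 / 250 * (2 * (bohr Γ r₂).card) := by
        gcongr
        rwa [card_bohr_halfFreq hG Γ r₂] at hXc
      have h2 := mul_le_mul_of_nonneg_left hA₂c hα.le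
      have h3 : 0 ≤ α ^ 2 * (bohr Γ r₂).card := by positivity
      linarith
    have hpow := one_add_three_mul_pow_le hl1
    have hEpos : 0 < E.card * α := by rw [hEc]; positivity
    have hS0 : 0 ≤ (E.card : ℝ) * α * (51 / 50) := by positivity
    -- The contradiction is numerical: the average of F + α over E is at least 7α/5, yet at most
    -- (53/50)(51/50)α.
    have hub : (1 + 3 * (1 / (60 * l : ℝ))) ^ l * (∑ x ∈ E, f x + E.card * α +
        l * (2 * (α ^ 2 / (1000 * l)) * (X 0).card * 2)) ≤ 53 / 50 * (E.card * α * (51 / 50)) := by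
      refine (mul_le_mul_of_nonneg_left ?_ (by positivity)).trans
        (mul_le_mul_of_nonneg_right hpow hS0)
      linarith
    linarith

end Increment

/-! ### The dichotomy and the final bounds. -/

section Main

/-- All losses are powers of q = α/(2d) ≤ 1/2: 13d and 28d from the two Bohr sets and 11 ≤ 11d from
the densities, 52d in total, while log(2d/α) = -log q. -/
theorem exp_mul_sq_le_of_card_bounds {α b b₁ b₂ : ℝ} (hα : 0 < α) (hα1 : α ≤ 1) {d : ℕ}
    (hd : 1 ≤ d) (hb : 0 ≤ b) (h₁ : (α / (8000 * d)) ^ d * b ≤ b₁)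
    (h₂ : (α / (160000000 * (d : ℝ) ^ 2)) ^ d * b ≤ b₂) :
    Real.exp (-(3 * 10 ^ 8 * d * Real.log (2 * d / α))) * b ^ 2 ≤ α ^ 3 / 200 * (b₁ * b₂) := by
  have hd' : (1 : ℝ) ≤ d := by exact_mod_cast hd
  set q : ℝ := α / (2 * d) with hq
  have hq0 : 0 < q := by positivity
  have hqα : q ≤ α := div_le_self hα.le (by linarith)
  have hq2 : q ≤ 1 / 2 := by
    rw [hq, div_le_div_iff₀ (by positivity) (by norm_num)]
    linarith
  have hlog : Real.log (2 * d / α) = -Real.log q := by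
    rw [hq, ← Real.log_inv, inv_div]
  have hlq : Real.log q ≤ 0 := Real.log_nonpos hq0.le (by linarith)
  have hpow : ∀ n : ℕ, q ^ n ≤ (1 / 2) ^ n := fun n => by gcongr
  have p1 : q ^ 13 ≤ α / (8000 * d) := by
    have e : α / (8000 * d) = q * (1 / 4000) := by rw [hq]; field_simp; ring
    rw [e, pow_succ']
    have := hpow 12
    gcongr
    exact this.trans (by norm_num)
  have p2 : q ^ 28 ≤ α / (160000000 * (d : ℝ) ^ 2) := by
    have e : α / (160000000 * (d : ℝ) ^ 2) = q ^ 2 * (1 / (40000000 * α)) := by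
      rw [hq]; field_simp; ring
    have e2 : q ^ 28 = q ^ 2 * q ^ 26 := by ring
    rw [e, e2]
    have h26 := hpow 26
    gcongr
    rw [le_div_iff₀ (by positivity)]
    have h3 : q ^ 26 * (40000000 * α) ≤ (1 / 2) ^ 26 * (40000000 * 1) := by gcongr
    exact h3.trans (by norm_num)
  have p3 : q ^ 11 ≤ α ^ 3 / 200 := by
    have e2 : q ^ 11 = q ^ 3 * q ^ 8 := by ring
    have h8 := hpow 8
    calc q ^ 11 = q ^ 3 * q ^ 8 := e2
      _ ≤ α ^ 3 * (1 / 2) ^ 8 := by gcongr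
      _ ≤ α ^ 3 / 200 := by
        have : 0 < α ^ 3 := by positivity
        linarith
  have hexp : Real.exp (-(3 * 10 ^ 8 * d * Real.log (2 * d / α))) ≤ q ^ (52 * d) := by
    rw [← Real.exp_log (pow_pos hq0 (52 * d)), Real.log_pow, hlog]
    refine Real.exp_le_exp.2 ?_
    push_cast
    have : (d : ℝ) * Real.log q ≤ 0 := mul_nonpos_of_nonneg_of_nonpos (by linarith) hlq
    linarith
  have hsplit : q ^ (52 * d) ≤ q ^ 11 * ((q ^ 13) ^ d * (q ^ 28) ^ d) := by
    have e : q ^ (52 * d) = q ^ (11 * d) * ((q ^ 13) ^ d * (q ^ 28) ^ d) := by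
      rw [← pow_mul, ← pow_mul, ← pow_add, ← pow_add]
      congr 1
      ring
    rw [e]
    gcongr ?_ * _
    exact pow_le_pow_of_le_one hq0.le (by linarith) (by omega)
  have b1 : (q ^ 13) ^ d * b ≤ b₁ := le_trans (by gcongr) h₁
  have b2 : (q ^ 28) ^ d * b ≤ b₂ := le_trans (by gcongr) h₂
  have hb₁ : 0 ≤ b₁ := le_trans (by positivity) b1
  calc _ ≤ q ^ 11 * ((q ^ 13) ^ d * (q ^ 28) ^ d) * b ^ 2 := by
        gcongr
        exact hexp.trans hsplit
    _ = q ^ 11 * (((q ^ 13) ^ d * b) * ((q ^ 28) ^ d * b)) := by ring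
    _ ≤ α ^ 3 / 200 * (b₁ * b₂) := by gcongr

/-- Only a fixed power of α is lost in the radius; since log(2/α) ≥ 69/100, the exponent 3 · 10⁸
log(2/α) exceeds 13. -/
theorem radius_bound_le {α ρ r d : ℝ} (hα : 0 < α) (hα1 : α ≤ 1) (hρ : 0 ≤ ρ) (hd : 1 ≤ d)
    (h : α ^ 13 * ρ / (10 ^ 37 * d ^ 5) ≤ r) :
    1 / 10 ^ 37 * ρ * α ^ (3 * 10 ^ 8 * Real.log (2 / α)) / d ^ 5 ≤ r := by
  refine le_trans ?_ h
  have hL := (log_two_div_bounds hα hα1).1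
  have h1 : α ^ (3 * 10 ^ 8 * Real.log (2 / α)) ≤ α ^ 13 := by
    rw [← Real.rpow_natCast α 13]
    refine Real.rpow_le_rpow_of_exponent_ge hα hα1 ?_
    push_cast
    linarith
  calc _ ≤ 1 / 10 ^ 37 * ρ * α ^ 13 / d ^ 5 := by gcongr
    _ = _ := by field_simp

variable {G : Type*} [AddCommGroup G] [Fintype G]

set_option maxHeartbeats 600000 in
/-- Many progressions, or a density increment on one of three kinds of Bohr sets. -/
theorem many_progressions_or_increment (hG : Odd (Fintype.card G)) {Γ : Finset (AddChar G ℂ)}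
    (hΓ : 1 ≤ Γ.card) {ρ α : ℝ} (hρ : 0 ≤ ρ) (hρ2 : ρ ≤ 2) (hreg : RegularRadius Γ ρ)
    {A : Finset G} (hA : A ⊆ bohr Γ ρ) (hα : 0 < α) (hα1 : α ≤ 1)
    (hAc : α * (bohr Γ ρ).card ≤ A.card) :
    Real.exp (-(3 * 10 ^ 8 * Γ.card * Real.log (2 * Γ.card / α))) * (A.card : ℝ) ^ 2 ≤ numAP A ∨
    ∃ (Δ : Finset (AddChar G ℂ)) (ω : ℝ), 0 ≤ ω ∧ 2 * ω ≤ ρ ∧ (Γ ⊆ Δ ∨ halfFreq Γ ⊆ Δ) ∧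
      RegularRadius Δ ω ∧ (Δ.card : ℝ) ≤ Γ.card + 3 * 10 ^ 8 * α⁻¹ * Real.log (2 / α) ^ 4 ∧
      α ^ 13 * ρ / (10 ^ 37 * (Γ.card : ℝ) ^ 5) ≤ ω ∧
      ∃ x, 9 / 8 * α ≤ conv (ind A) (unif (bohr Δ ω)) x := by
  set d : ℝ := (Γ.card : ℝ) with hd
  have hd1 : 1 ≤ d := by rw [hd]; exact_mod_cast hΓ
  have hL := (log_two_div_bounds hα hα1).1
  have hBpos : (0 : ℝ) < (bohr Γ ρ).card := card_bohr_pos hρ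
  -- The factor 400 makes the boundary loss 12dκ equal to 3α/100; the factor 5000 below gives
  -- 72/5000 ≤ 1/64 in `exists_increment`.
  obtain ⟨r₁, hr₁l, hr₁u, hreg₁⟩ := exists_regularRadius hΓ (ρ := α / (400 * d) * ρ) (by positivity)
  have hr₁ : 0 ≤ r₁ := le_trans (by positivity) hr₁l
  obtain ⟨r₂, hr₂l, hr₂u, hreg₂⟩ := exists_regularRadius hΓ (ρ := 1 / (5000 * d) * r₁)
    (by positivity)
  have hr₂ : 0 ≤ r₂ := le_trans (by positivity) hr₂l
  have hr₂r₁ : r₂ ≤ r₁ := hr₂u.trans (mul_le_of_le_one_left hr₁ (by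
    rw [div_le_one (by positivity)]; linarith))
  have hκρ : α / (400 * d) ≤ 1 / 2 := by
    rw [div_le_div_iff₀ (by positivity) (by norm_num)]; linarith
  have hr₁ρ : 2 * r₁ ≤ ρ := by
    have := mul_le_mul_of_nonneg_right hκρ hρ
    linarith
  have hr₁ge : α / (1600 * d) * ρ ≤ r₁ := by
    refine le_trans (le_of_eq ?_) hr₁l
    field_simp; ring
  have hr₂ge : α / (32000000 * d ^ 2) * ρ ≤ r₂ := by
    calc α / (32000000 * d ^ 2) * ρ = 1 / (5000 * d) * (α / (1600 * d) * ρ) / 4 := by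
          field_simp; ring
      _ ≤ 1 / (5000 * d) * r₁ / 4 := by gcongr
      _ ≤ r₂ := hr₂l
  have hrank : d ≤ d + 3 * 10 ^ 8 * α⁻¹ * Real.log (2 / α) ^ 4 := by
    have : 0 ≤ 3 * 10 ^ 8 * α⁻¹ * Real.log (2 / α) ^ 4 := by positivity
    linarith
  have hr₂rad : α ^ 13 * ρ / (10 ^ 37 * d ^ 5) ≤ r₂ := by
    refine le_trans ?_ hr₂ge
    rw [div_mul_eq_mul_div]
    have h1 : α ^ 13 ≤ α := by
      calc α ^ 13 ≤ α ^ 1 := pow_le_pow_of_le_one hα.le hα1 (by norm_num)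
        _ = α := pow_one α
    have h2 : d ^ 2 ≤ d ^ 5 := pow_le_pow_right₀ hd1 (by norm_num)
    gcongr
    norm_num
  by_cases hinc₁ : ∃ x, 9 / 8 * α ≤ conv (ind A) (unif (bohr Γ r₁)) x
  · exact Or.inr ⟨Γ, r₁, hr₁, hr₁ρ, Or.inl Subset.rfl, hreg₁, hrank, hr₂rad.trans hr₂r₁, hinc₁⟩
  by_cases hinc₂ : ∃ x, 9 / 8 * α ≤ conv (ind A) (unif (bohr Γ r₂)) x
  · exact Or.inr ⟨Γ, r₂, hr₂, by linarith, Or.inl Subset.rfl, hreg₂, hrank, hr₂rad, hinc₂⟩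
  push Not at hinc₁ hinc₂
  have h12 : 12 * d * (α / (400 * d)) = 3 / 100 * α := by field_simp; ring
  have hs₁ := le_sum_conv_unif hreg hρ (κ := α / (400 * d)) (by positivity)
    (by rw [h12]; linarith) hr₁ hr₁u hA
  have hs₂ := le_sum_conv_unif hreg hρ (κ := α / (400 * d)) (by positivity)
    (by rw [h12]; linarith) hr₂ (hr₂r₁.trans hr₁u) hA
  rw [h12] at hs₁ hs₂
  -- The two densities have mean sum at least 2(1 - 3/100)α ≥ 31α/16. As each is below 9α/8, each is
  -- at least 31α/16 - 9α/8 = 13α/16.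
  obtain ⟨u, -, hu⟩ : ∃ u ∈ bohr Γ ρ, 31 / 16 * α ≤
      conv (ind A) (unif (bohr Γ r₁)) u + conv (ind A) (unif (bohr Γ r₂)) u := by
    by_contra! hlt
    have h1 := sum_le_sum fun x hx => (hlt x hx).le
    rw [sum_add_distrib, sum_const, nsmul_eq_mul] at h1
    have h2 := mul_pos hα hBpos
    linarith
  have hu₁ := hinc₁ u
  have hu₂ := hinc₂ u
  have hB₁pos : (0 : ℝ) < (bohr Γ r₁).card := card_bohr_pos hr₁
  have hB₂pos : (0 : ℝ) < (bohr Γ r₂).card := card_bohr_pos hr₂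
  set A₁ := translatePart A (bohr Γ r₁) u with hA₁
  set A₂ := translatePart A (bohr Γ r₂) u with hA₂
  have hA₁c : 13 / 16 * α * (bohr Γ r₁).card ≤ A₁.card := by
    rw [hA₁, card_translatePart hr₁]
    gcongr
    linarith
  have hA₂c : 13 / 16 * α * (bohr Γ r₂).card ≤ A₂.card := by
    rw [hA₂, card_translatePart hr₂]
    gcongr
    linarith
  by_cases hfew : ∑ b ∈ A₂, conv (ind A₁) (unif A₁) (2 • b) ≤ α / 100 * A₂.card
  · right
    obtain ⟨Δ, ω, hω0, hω, hΔ, hregω, hΔc, hωl, x, hx⟩ := exists_increment hG hΓ hr₁ hr₂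
      (by linarith) hreg₁ hreg₂ (κ := 1 / (5000 * d)) (by positivity)
      (by
        have : 12 * d * (6 * (1 / (5000 * d))) = 72 / 5000 := by field_simp; ring
        rw [← hd, this]; norm_num)
      hr₂u hα hα1 (fun y hy => (mem_translatePart.1 hy).1)
      (fun y hy => (mem_translatePart.1 hy).1) hA₁c hA₂c hfew
    refine ⟨Δ, ω, hω0, by linarith, Or.inr hΔ, hregω, hΔc, ?_, u + x,
      hx.trans (conv_translatePart_le _ _ _ _ _)⟩
    refine le_trans ?_ hωl
    rw [← hd]
    calc α ^ 13 * ρ / (10 ^ 37 * d ^ 5) ≤ α ^ 13 * ρ / (10 ^ 29 * 32000000 * d ^ 5) := by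
          gcongr; norm_num
      _ = α ^ 12 * (α / (32000000 * d ^ 2) * ρ) / (10 ^ 29 * d ^ 3) := by
          field_simp
      _ ≤ _ := by gcongr
  · left
    push Not at hfew
    have hcount := card_mul_sum_conv_le_numAP A (bohr Γ r₁) (bohr Γ r₂) u
    rw [← hA₁, ← hA₂] at hcount
    have hAB : (A.card : ℝ) ≤ (bohr Γ ρ).card := by exact_mod_cast card_le_card hA
    have hsize₁ : (α / (8000 * d)) ^ Γ.card * ((bohr Γ ρ).card : ℝ) ≤ (bohr Γ r₁).card := by
      have h := card_bohr_mul_ge Γ hρ (τ := α / (1600 * d)) (by positivity) (by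
        rw [div_le_one (by positivity)]; linarith)
      have e : α / (1600 * d) / 5 = α / (8000 * d) := by field_simp; ring
      rw [e] at h
      exact h.trans (by exact_mod_cast card_le_card (bohr_mono hr₁ge))
    have hsize₂ : (α / (160000000 * d ^ 2)) ^ Γ.card * ((bohr Γ ρ).card : ℝ) ≤
        (bohr Γ r₂).card := by
      have h := card_bohr_mul_ge Γ hρ (τ := α / (32000000 * d ^ 2)) (by positivity) (by
        rw [div_le_one (by positivity)]
        nlinarith)
      have e : α / (32000000 * d ^ 2) / 5 = α / (160000000 * d ^ 2) := by field_simp; ring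
      rw [e] at h
      exact h.trans (by exact_mod_cast card_le_card (bohr_mono hr₂ge))
    have hnum := exp_mul_sq_le_of_card_bounds hα hα1 hΓ hBpos.le hsize₁ hsize₂
    calc _ ≤ Real.exp (-(3 * 10 ^ 8 * d * Real.log (2 * d / α))) * ((bohr Γ ρ).card : ℝ) ^ 2 := by
          gcongr
      _ ≤ α ^ 3 / 200 * ((bohr Γ r₁).card * (bohr Γ r₂).card) := hnum
      _ ≤ (13 / 16 * α * (bohr Γ r₁).card) * (α / 100 * (13 / 16 * α * (bohr Γ r₂).card)) := by
          have : 0 ≤ α ^ 3 * ((bohr Γ r₁).card * (bohr Γ r₂).card : ℝ) := by positivity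
          linarith
      _ ≤ A₁.card * (α / 100 * A₂.card) := by gcongr
      _ ≤ A₁.card * ∑ b ∈ A₂, conv (ind A₁) (unif A₁) (2 • b) := by gcongr
      _ ≤ numAP A := hcount

end Main

theorem mainTheorem3 :
    ∃ c C : ℝ, 0 < c ∧ 0 < C ∧
      ∀ (G : Type*) [AddCommGroup G] [Fintype G], Odd (Fintype.card G) →
      ∀ B : BohrSet G, B.IsRegular → 1 ≤ B.rank → B.radius ≤ 2 →
      ∀ A : Finset G, A ⊆ B.carrier →
      ∀ α : ℝ, 0 < α → α ≤ (A.card : ℝ) / (B.carrier.card : ℝ) →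
        Real.exp (-(C * (B.rank : ℝ) * Real.log (2 * (B.rank : ℝ) / α))) * (A.card : ℝ) ^ 2
            ≤ (numAP A : ℝ) ∨
        ∃ T : BohrSet G, T.IsRegular ∧ (T ≤ B ∨ T ≤ B.double) ∧ T.carrier ⊆ B.carrier ∧
          (T.rank : ℝ) ≤ (B.rank : ℝ) + C * α⁻¹ * Real.log (2 / α) ^ 4 ∧
          c * B.radius * α ^ (C * Real.log (2 / α)) / (B.rank : ℝ) ^ 5 ≤ T.radius ∧
          9 / 8 * α ≤ supNorm (conv (ind A) (unif T.carrier)) := by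
  refine ⟨1 / 10 ^ 37, 3 * 10 ^ 8, by norm_num, by norm_num, ?_⟩
  intro G _ _ hG B hreg hrank hρ2 A hA α hα hAα
  have hBpos : (0 : ℝ) < B.carrier.card := card_bohr_pos B.radius_nonneg
  have hAB : (A.card : ℝ) ≤ B.carrier.card := by exact_mod_cast card_le_card hA
  have hα1 : α ≤ 1 := hAα.trans (div_le_one_of_le₀ hAB hBpos.le)
  have hd : (1 : ℝ) ≤ B.rank := by exact_mod_cast hrank
  rw [BohrSet.isRegular_iff] at hreg
  rcases many_progressions_or_increment hG hrank B.radius_nonneg hρ2 hreg hA hα hα1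
    ((le_div_iff₀ hBpos).1 hAα) with h | ⟨Δ, ω, hω0, hω, hΔ, hregω, hΔc, hωl, x, hx⟩
  · exact Or.inl h
  · refine Or.inr ⟨⟨Δ, ω, hω0⟩, (BohrSet.isRegular_iff _).2 hregω, ?_, ?_, hΔc,
      radius_bound_le hα hα1 B.radius_nonneg hd hωl, hx.trans (le_supNorm _ x)⟩
    · exact hΔ.imp (fun h => ⟨h, by linarith⟩) fun h => ⟨h, by
        show ω ≤ B.radius
        linarith⟩
    · show bohr Δ ω ⊆ bohr B.freq B.radius
      rcases hΔ with h | h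
      · exact (bohr_mono (by linarith)).trans (bohr_anti h)
      -- The case T ≤ 2·B: the underlying set lies in Bohr(Γ, 2ω), hence in B because 2ω ≤ ρ.
      · exact ((bohr_anti h).trans (bohr_halfFreq_subset hG _ _)).trans (bohr_mono hω)
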